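/- **Setting.** Let $\Gamma$ be a finite simplicial graph with vertex set $V$, $A_\Gamma$ its right-angled Artin group (generators $V$; relations $[v,w]=1$ for adjacent $v,w$), and $V^{\pm}=V\sqcup V^{-1}$. For vertices, $v\le w$ means $lk(v)\subseteq st(w)$; adjacency and $\le$ are extended to $V^\pm$ through the underlying vertices. Let $Out_\ell(A_\Gamma)\le Out(A_\Gamma)$ be the subgroup generated by graph automorphisms, inversions, partial conjugations (conjugating one component of $\Gamma\setminus st(v)$ by $v$) and non-adjacent transvections ($v\mapsto vw$ with $v\neq w$, $v\le w$, $v,w$ not adjacent). A *Whitehead pair* $(P,m)$ consists of $P\subset V^\pm$ with at least two elements and $m\in P$ with $m^{-1}\notin P$ such that (1) no element of $P$ is adjacent to $m$; (2) if $x\in P$ and $x^{-1}\notin P$ then $x\le m$; (3) if $v,v^{-1}\in P$ then $w,w^{-1}\in P$ for all $w$ in the component of $v$ in $\Gamma\setminus st(m)$. It determines the Whitehead automorphism $\alpha_{(P,m)}$ of $A_\Gamma$, which sends $m\mapsto m^{-1}$ and, for $x\in V^\pm$ with $x\ne m^{\pm1}$, sends $x$ to $xm^{-1}$ if $x\in P,\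 x^{-1}\notin P$; to $mx$ if $x^{-1}\in P,\ x\notin P$; to $mxm^{-1}$ if $x,x^{-1}\in P$; and to $x$ otherwise. Its class lies in $Out_\ell(A_\Gamma)$. A *marked Salvetti* $(\mathbb S,\varphi)$ is the Salvetti complex $\mathbb S$ of $A_\Gamma$ with a marking $\varphi\in Out_\ell(A_\Gamma)$ (homotopy classes of self-homotopy equivalences of $\mathbb S$ being identified with $Out(A_\Gamma)$), up to the equivalence $(\mathbb S,\varphi)\sim(\mathbb S,\varphi\circ h)$ for $h$ in the group generated by graph automorphisms and inversions. For $\sigma=(\mathbb S,\varphi)$ and a Whitehead pair $(P,m)$, the *Whitehead move* at $\sigma$ leads to $\sigma^P_m=(\mathbb S,\varphi\circ\alpha_{(P,m)})$. A *Whitehead path* is a finite sequence of marked Salvettis in which each term after the first is obtained from the preceding one by a Whitehead move. For a conjugacy class $g$ of $A_\Gamma$ let $\ell_\sigma(g)$ be the minimal length of a word in $V^\pm$ representing an element of the conjugacy class $\varphi^{-1}(g)$, and put $\|\sigma\|_0=\sum_{g\in\mathcal G_0}\ell_\sigma(g)$, where $\mathcal G_0$ is the (finite) set of conjugacy classes represented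 by words of length at most $2$. **Theorem (Strong Peak Reduction).** Let $\sigma=(\mathbb S,\varphi)$ be a marked Salvetti and let $(P,v)$ and $(Q,w)$ be Whitehead pairs such that $\|\sigma^P_v\|_0<\|\sigma\|_0$ and $\|\sigma^Q_w\|_0\le\|\sigma\|_0$. Then there is a Whitehead path $\sigma^P_v=\tau_0,\tau_1,\dots,\tau_k=\sigma^Q_w$ (with $k\ge 0$) such that $\|\tau_i\|_0<\|\sigma\|_0$ for all $0\le i<k$. -/

import Mathlib

namespace WhiteheadRAAG

/-! ### Right-angled Artin groups -/

section Group

variable {V : Type*}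

/-- The defining relators of the right-angled Artin group of `Γ`: the commutators `[v, w]`,
one for each pair of adjacent vertices. -/
def relators (Γ : SimpleGraph V) : Set (FreeGroup V) :=
  {r | ∃ v w : V, Γ.Adj v w ∧ r = FreeGroup.of v * FreeGroup.of w * (FreeGroup.of v)⁻¹ * (FreeGroup.of w)⁻¹}

/-- The right-angled Artin group `A_Γ`. -/
abbrev RAAG (Γ : SimpleGraph V) : Type _ := PresentedGroup (relators Γ)

/-- The generator of `A_Γ` given by a vertex. -/
def gen (Γ : SimpleGraph V) (v : V) : RAAG Γ := PresentedGroup.of v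

/-- The symmetric set `V^±`: the pair `(v, true)` is `v`, the pair `(v, false)` is `v⁻¹`. -/
abbrev Letter (V : Type*) : Type _ := V × Bool

/-- The formal inverse of a letter. -/
def Letter.inv (x : Letter V) : Letter V := (x.1, !x.2)

/-- The element of `A_Γ` represented by a letter. -/
def letterVal (Γ : SimpleGraph V) (x : Letter V) : RAAG Γ :=
  if x.2 then gen Γ x.1 else (gen Γ x.1)⁻¹

/-- The element of `A_Γ` represented by a word in the letters `V^±`. -/
def wordVal (Γ : SimpleGraph V) (w : List (Letter V)) : RAAG Γ :=
  (w.map (letterVal Γ)).prod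

theorem gen_commute {Γ : SimpleGraph V} {v w : V} (h : Γ.Adj v w) :
    Commute (gen Γ v) (gen Γ w) := by
  have h1 : gen Γ v * gen Γ w * (gen Γ v)⁻¹ * (gen Γ w)⁻¹ = 1 :=
    PresentedGroup.one_of_mem ⟨v, w, h, rfl⟩
  exact mul_inv_eq_iff_eq_mul.1 (mul_inv_eq_one.1 h1)

theorem exists_word (Γ : SimpleGraph V) (a : RAAG Γ) : ∃ w, wordVal Γ w = a := by
  have key : ∀ g ∈ Subgroup.closure (Set.range (gen Γ)), ∃ w, wordVal Γ w = g := by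
    intro g hg
    induction hg using Subgroup.closure_induction'' with
    | one => exact ⟨[], rfl⟩
    | mem x hx =>
      obtain ⟨v, rfl⟩ := hx
      exact ⟨[(v, true)], by simp [wordVal, letterVal]⟩
    | inv_mem x hx =>
      obtain ⟨v, rfl⟩ := hx
      exact ⟨[(v, false)], by simp [wordVal, letterVal]⟩
    | mul x y _ _ hx hy =>
      obtain ⟨w, rfl⟩ := hx
      obtain ⟨u, rfl⟩ := hy
      exact ⟨w ++ u, by simp [wordVal]⟩
  refine key a ?_
  have h := PresentedGroup.closure_range_of (relators Γ)
  have h2 : a ∈ Subgroup.closure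
      (Set.range (PresentedGroup.of : V → PresentedGroup (relators Γ))) := by
    rw [h]; trivial
  exact h2

theorem aut_ext {Γ : SimpleGraph V} {α β : MulAut (RAAG Γ)}
    (h : ∀ v, α (gen Γ v) = β (gen Γ v)) : α = β := by
  have h1 : α.toMonoidHom = β.toMonoidHom := PresentedGroup.ext h
  ext x
  exact DFunLike.congr_fun h1 x

end Group

/-! ### Outer automorphisms and the action on conjugacy classes -/

section Outer

variable {G : Type*} [Group G]

instance innNormal : (MulAut.conj : G →* MulAut G).range.Normal := by
  constructor
  rintro _ ⟨g, rfl⟩ α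
  refine ⟨α g, ?_⟩
  ext x
  simp [MulAut.conj_apply]

/-- The outer automorphism group of `G`: automorphisms modulo inner automorphisms. -/
abbrev Out (G : Type*) [Group G] : Type _ := MulAut G ⧸ (MulAut.conj : G →* MulAut G).range

/-- The outer automorphism represented by an automorphism. -/
def toOut : MulAut G →* Out G := QuotientGroup.mk' _

/-- Automorphisms act on conjugacy classes. -/
def autConj : MulAut G →* Equiv.Perm (ConjClasses G) where
  toFun α :=
    { toFun := ConjClasses.map α.toMonoidHom
      invFun := ConjClasses.map (α⁻¹).toMonoidHom
      left_inv := by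
        intro c
        obtain ⟨a, rfl⟩ := ConjClasses.exists_rep c
        exact congrArg ConjClasses.mk (MulAut.inv_apply_self G α a)
      right_inv := by
        intro c
        obtain ⟨a, rfl⟩ := ConjClasses.exists_rep c
        exact congrArg ConjClasses.mk (MulAut.apply_inv_self G α a) }
  map_one' := by
    ext c
    obtain ⟨a, rfl⟩ := ConjClasses.exists_rep c
    rfl
  map_mul' α β := by
    ext c
    obtain ⟨a, rfl⟩ := ConjClasses.exists_rep c
    rfl

theorem autConj_mk (α : MulAut G) (a : G) :
    autConj α (ConjClasses.mk a) = ConjClasses.mk (α a) := rfl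

/-- Outer automorphisms act on conjugacy classes. -/
def outConj : Out G →* Equiv.Perm (ConjClasses G) :=
  QuotientGroup.lift _ autConj (by
    rintro _ ⟨g, rfl⟩
    rw [MonoidHom.mem_ker]
    ext c
    obtain ⟨a, rfl⟩ := ConjClasses.exists_rep c
    rw [autConj_mk, Equiv.Perm.one_apply, ConjClasses.mk_eq_mk_iff_isConj, isConj_comm,
      isConj_iff]
    exact ⟨g, rfl⟩)

theorem outConj_toOut (α : MulAut G) (a : G) :
    outConj (toOut α) (ConjClasses.mk a) = ConjClasses.mk (α a) := rfl

end Outer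

/-! ### The long-range outer automorphism group -/

section LongRange

variable {V : Type*} (Γ : SimpleGraph V)

/-- The star of a vertex. -/
def star (v : V) : Set V := insert v (Γ.neighborSet v)

/-- The relation `v ≤ w`, that is `lk(v) ⊆ st(w)`. -/
def VLE (v w : V) : Prop := Γ.neighborSet v ⊆ star Γ w

/-- `v` and `w` are vertices outside `st(m)` that lie in the same connected component of
`Γ ∖ st(m)`. -/
def SameComponent (m v w : V) : Prop :=
  ∃ (hv : v ∈ (star Γ m)ᶜ) (hw : w ∈ (star Γ m)ᶜ),
    (Γ.induce (star Γ m)ᶜ).Reachable ⟨v, hv⟩ ⟨w, hw⟩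

/-- `α` is the automorphism induced by an automorphism of the graph. -/
def IsGraphAut (α : MulAut (RAAG Γ)) : Prop :=
  ∃ f : Γ ≃g Γ, ∀ v, α (gen Γ v) = gen Γ (f v)

/-- `α` inverts one generator and fixes all the others. -/
def IsInversion (α : MulAut (RAAG Γ)) : Prop :=
  ∃ v, α (gen Γ v) = (gen Γ v)⁻¹ ∧ ∀ u, u ≠ v → α (gen Γ u) = gen Γ u

/-- `α` is a non-adjacent transvection: `v ↦ v w` for some non-adjacent distinct `v ≤ w`,
all other generators being fixed. -/
def IsNonadjTransvection (α : MulAut (RAAG Γ)) : Prop :=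
  ∃ v w, v ≠ w ∧ ¬ Γ.Adj v w ∧ VLE Γ v w ∧
    α (gen Γ v) = gen Γ v * gen Γ w ∧ ∀ u, u ≠ v → α (gen Γ u) = gen Γ u

/-- `α` is a partial conjugation: it conjugates the vertices of one component of `Γ ∖ st(v)`
(the component of `c`) by `v` and fixes all other generators. -/
def IsPartialConj (α : MulAut (RAAG Γ)) : Prop :=
  ∃ v c, c ∉ star Γ v ∧
    (∀ u, SameComponent Γ v c u → α (gen Γ u) = gen Γ v * gen Γ u * (gen Γ v)⁻¹) ∧
    (∀ u, ¬ SameComponent Γ v c u → α (gen Γ u) = gen Γ u)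

/-- The group of long-range (untwisted) outer automorphisms, generated by graph automorphisms,
inversions, partial conjugations and non-adjacent transvections. -/
def OutL : Subgroup (Out (RAAG Γ)) :=
  Subgroup.closure (toOut ''
    {α | IsGraphAut Γ α ∨ IsInversion Γ α ∨ IsPartialConj Γ α ∨ IsNonadjTransvection Γ α})

/-- The group generated by graph automorphisms and inversions, that is, the group of outer
automorphisms represented by isomorphisms of the Salvetti complex. -/
def signedSymm : Subgroup (Out (RAAG Γ)) :=
  Subgroup.closure (toOut '' {α | IsGraphAut Γ α ∨ IsInversion Γ α})

end LongRange

/-! ### Whitehead pairs and their automorphisms -/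

section Pairs

variable {V : Type*} {Γ : SimpleGraph V} {P : Set (Letter V)} {m : Letter V}

/-- The conditions on a (possibly degenerate) Whitehead pair `(P, m)`. -/
structure WhiteheadConditions (Γ : SimpleGraph V) (P : Set (Letter V)) (m : Letter V) :
    Prop where
  mem : m ∈ P
  inv_notMem : m.inv ∉ P
  not_adj : ∀ x ∈ P, ¬ Γ.Adj x.1 m.1
  le : ∀ x ∈ P, x.inv ∉ P → VLE Γ x.1 m.1
  comp : ∀ v, (v, true) ∈ P → (v, false) ∈ P →
    ∀ w, SameComponent Γ m.1 v w → (w, true) ∈ P ∧ (w, false) ∈ P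

/-- `(P, m)` is a Whitehead pair for `Γ`: in addition `P` has at least two elements. -/
structure IsWhiteheadPair (Γ : SimpleGraph V) (P : Set (Letter V)) (m : Letter V) : Prop
    extends WhiteheadConditions Γ P m where
  two_le : P.Nontrivial

open Classical in
/-- The values of the Whitehead automorphism `(P, m)` on generators. As an assignment on letters
it reads `m ↦ m⁻¹` and, for `x ≠ m, m⁻¹`: `x ↦ x m⁻¹` if only `x ∈ P`, `x ↦ m x` if only
`x⁻¹ ∈ P`, `x ↦ m x m⁻¹` if both, `x ↦ x` if neither. -/
noncomputable def whiteheadFun (Γ : SimpleGraph V) (P : Set (Letter V)) (m : Letter V) (v : V) :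
    RAAG Γ :=
  if v = m.1 then (gen Γ v)⁻¹
  else if (v, true) ∈ P then
    if (v, false) ∈ P then letterVal Γ m * gen Γ v * (letterVal Γ m)⁻¹
    else gen Γ v * (letterVal Γ m)⁻¹
  else
    if (v, false) ∈ P then letterVal Γ m * gen Γ v
    else gen Γ v

theorem letterVal_inv (x : Letter V) : letterVal Γ x.inv = (letterVal Γ x)⁻¹ := by
  obtain ⟨v, b⟩ := x
  cases b <;> simp [letterVal, Letter.inv]

theorem WhiteheadConditions.single_adj (h : WhiteheadConditions Γ P m) {v w : V}
    (hvw : Γ.Adj v w) (hw : w ≠ m.1) (hwm : ¬ Γ.Adj w m.1) {b : Bool}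
    (hP : (v, b) ∈ P) : (v, !b) ∈ P := by
  by_contra hn
  have := h.le (v, b) hP hn hvw
  rcases this with h1 | h1
  · exact hw h1
  · exact hwm (Γ.adj_symm h1)

theorem WhiteheadConditions.whiteheadFun_of_adj (h : WhiteheadConditions Γ P m) {v : V}
    (hv : Γ.Adj v m.1) : whiteheadFun Γ P m v = gen Γ v := by
  have h1 : (v, true) ∉ P := fun hP => h.not_adj _ hP hv
  have h2 : (v, false) ∉ P := fun hP => h.not_adj _ hP hv
  simp [whiteheadFun, hv.ne, h1, h2]

theorem letterVal_commute {v : V} {x : Letter V} (hv : Γ.Adj v x.1) :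
    Commute (gen Γ v) (letterVal Γ x) := by
  unfold letterVal
  split_ifs
  · exact gen_commute hv
  · exact (gen_commute hv).inv_right

theorem WhiteheadConditions.commute_of_adj (h : WhiteheadConditions Γ P m) {v w : V}
    (hv : Γ.Adj v m.1) (hvw : Γ.Adj v w) :
    Commute (whiteheadFun Γ P m v) (whiteheadFun Γ P m w) := by
  rw [h.whiteheadFun_of_adj hv]
  have h1 := letterVal_commute hv
  have h2 := gen_commute hvw
  unfold whiteheadFun
  split_ifs
  · exact h2.inv_right
  · exact (h1.mul_right h2).mul_right h1.inv_right
  · exact h2.mul_right h1.inv_right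
  · exact h1.mul_right h2
  · exact h2

theorem WhiteheadConditions.commute (h : WhiteheadConditions Γ P m) {v w : V}
    (hvw : Γ.Adj v w) : Commute (whiteheadFun Γ P m v) (whiteheadFun Γ P m w) := by
  by_cases hv : Γ.Adj v m.1
  · exact h.commute_of_adj hv hvw
  by_cases hw : Γ.Adj w m.1
  · exact (h.commute_of_adj hw hvw.symm).symm
  have hvm : v ≠ m.1 := by rintro rfl; exact hw hvw.symm
  have hwm : w ≠ m.1 := by rintro rfl; exact hv hvw
  have hvs : v ∈ (star Γ m.1)ᶜ := by
    rintro (h1 | h1)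
    · exact hvm h1
    · exact hv (Γ.adj_symm h1)
  have hws : w ∈ (star Γ m.1)ᶜ := by
    rintro (h1 | h1)
    · exact hwm h1
    · exact hw (Γ.adj_symm h1)
  have hc : SameComponent Γ m.1 v w := ⟨hvs, hws, SimpleGraph.Adj.reachable hvw⟩
  have hc' : SameComponent Γ m.1 w v := ⟨hws, hvs, SimpleGraph.Adj.reachable hvw.symm⟩
  have hg := gen_commute hvw
  by_cases hP : (v, true) ∈ P
  · have hP' : (v, false) ∈ P := h.single_adj hvw hwm hw hP
    obtain ⟨h3, h4⟩ := h.comp v hP hP' w hc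
    simp only [whiteheadFun, hvm, hwm, hP, hP', h3, h4, if_true, if_false]
    exact (Commute.conj_iff _).2 hg
  · have hP' : (v, false) ∉ P := fun h5 => hP (h.single_adj hvw hwm hw h5)
    have h3 : (w, true) ∉ P := fun h5 =>
      hP (h.comp w h5 (h.single_adj hvw.symm hvm hv h5) v hc').1
    have h4 : (w, false) ∉ P := fun h5 => h3 (h.single_adj hvw.symm hvm hv h5)
    simp only [whiteheadFun, hvm, hwm, hP, hP', h3, h4, if_false]
    exact hg

/-- The endomorphism of `A_Γ` defined by a (possibly degenerate) Whitehead pair. -/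
noncomputable def whiteheadHom (h : WhiteheadConditions Γ P m) : RAAG Γ →* RAAG Γ :=
  PresentedGroup.toGroup (f := whiteheadFun Γ P m) (by
    rintro r ⟨v, w, hvw, rfl⟩
    have h1 : whiteheadFun Γ P m v * whiteheadFun Γ P m w =
        whiteheadFun Γ P m w * whiteheadFun Γ P m v := h.commute hvw
    simp [h1])

theorem whiteheadHom_gen (h : WhiteheadConditions Γ P m) (v : V) :
    whiteheadHom h (gen Γ v) = whiteheadFun Γ P m v :=
  PresentedGroup.toGroup.of _

theorem whiteheadHom_m (h : WhiteheadConditions Γ P m) :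
    whiteheadHom h (letterVal Γ m) = (letterVal Γ m)⁻¹ := by
  obtain ⟨v, b⟩ := m
  cases b <;> simp [letterVal, whiteheadHom_gen, whiteheadFun]

theorem whiteheadHom_invol (h : WhiteheadConditions Γ P m) :
    (whiteheadHom h).comp (whiteheadHom h) = MonoidHom.id _ := by
  refine PresentedGroup.ext fun v => ?_
  change whiteheadHom h (whiteheadHom h (gen Γ v)) = gen Γ v
  have hv := whiteheadHom_gen h v
  have hm := whiteheadHom_m h
  by_cases h0 : v = m.1 <;> by_cases h1 : (v, true) ∈ P <;> by_cases h2 : (v, false) ∈ P <;>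
    simp only [whiteheadFun, h0, h1, h2, if_true, if_false] at hv ⊢ <;>
    simp only [hv, hm, map_mul, map_inv] <;> simp [mul_assoc]

/-- The Whitehead automorphism `(P, m)` of `A_Γ`. -/
noncomputable def whiteheadAut (h : WhiteheadConditions Γ P m) : MulAut (RAAG Γ) :=
  MonoidHom.toMulEquiv (whiteheadHom h) (whiteheadHom h)
    (whiteheadHom_invol h) (whiteheadHom_invol h)

theorem whiteheadAut_gen (h : WhiteheadConditions Γ P m) (v : V) :
    whiteheadAut h (gen Γ v) = whiteheadFun Γ P m v :=
  whiteheadHom_gen h v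

theorem whiteheadAut_m (h : WhiteheadConditions Γ P m) :
    whiteheadAut h (letterVal Γ m) = (letterVal Γ m)⁻¹ :=
  whiteheadHom_m h

theorem whiteheadAut_sq (h : WhiteheadConditions Γ P m) :
    whiteheadAut h * whiteheadAut h = 1 := by
  ext x
  exact DFunLike.congr_fun (whiteheadHom_invol h) x

/-! The Whitehead automorphism of a Whitehead pair represents a long-range outer automorphism. -/

theorem inversion_conditions (Γ : SimpleGraph V) (m : Letter V) :
    WhiteheadConditions Γ {m} m where
  mem := rfl
  inv_notMem := by
    obtain ⟨v, b⟩ := m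
    cases b <;> simp [Letter.inv]
  not_adj := by rintro x rfl; exact Γ.loopless.irrefl _
  le := by
    rintro x rfl _ y hy
    exact Or.inr hy
  comp := by
    rintro v h1 h2
    rw [Set.mem_singleton_iff] at h1 h2
    simp [← h1] at h2

theorem inversion_isInversion (Γ : SimpleGraph V) (m : Letter V) :
    IsInversion Γ (whiteheadAut (inversion_conditions Γ m)) := by
  refine ⟨m.1, ?_, ?_⟩
  · simp [whiteheadAut_gen, whiteheadFun]
  · intro u hu
    have h1 : ∀ b, (u, b) ≠ m := by rintro b rfl; exact hu rfl
    simp [whiteheadAut_gen, whiteheadFun, hu, h1]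

theorem inversion_mem {α : MulAut (RAAG Γ)} (h : IsInversion Γ α) : toOut α ∈ OutL Γ :=
  Subgroup.subset_closure ⟨α, Or.inr (Or.inl h), rfl⟩

theorem rightTransvection_mem {α : MulAut (RAAG Γ)} {u : V} {x : Letter V} (hux : u ≠ x.1)
    (hadj : ¬ Γ.Adj u x.1) (hle : VLE Γ u x.1)
    (h1 : α (gen Γ u) = gen Γ u * letterVal Γ x) (h2 : ∀ v, v ≠ u → α (gen Γ v) = gen Γ v) :
    toOut α ∈ OutL Γ := by
  obtain ⟨w, b⟩ := x
  cases b
  · rw [← inv_mem_iff, ← map_inv]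
    refine Subgroup.subset_closure ⟨_, Or.inr (Or.inr (Or.inr ⟨u, w, hux, hadj, hle, ?_, ?_⟩)), rfl⟩
    · apply α.injective
      rw [MulAut.apply_inv_self, map_mul, h1, h2 w hux.symm]
      simp [letterVal]
    · intro v hv
      apply α.injective
      rw [MulAut.apply_inv_self, h2 v hv]
  · exact Subgroup.subset_closure
      ⟨_, Or.inr (Or.inr (Or.inr ⟨u, w, hux, hadj, hle, by simpa [letterVal] using h1, h2⟩)), rfl⟩

theorem leftTransvection_mem {α : MulAut (RAAG Γ)} {u : V} {x : Letter V} (hux : u ≠ x.1)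
    (hadj : ¬ Γ.Adj u x.1) (hle : VLE Γ u x.1)
    (h1 : α (gen Γ u) = letterVal Γ x * gen Γ u) (h2 : ∀ v, v ≠ u → α (gen Γ v) = gen Γ v) :
    toOut α ∈ OutL Γ := by
  have hi := inversion_isInversion Γ (u, true)
  have hsq := whiteheadAut_sq (inversion_conditions Γ (u, true))
  have hm := inversion_mem hi
  set i := whiteheadAut (inversion_conditions Γ (u, true)) with hidef
  have hiu : i (gen Γ u) = (gen Γ u)⁻¹ := by simp [hidef, whiteheadAut_gen, whiteheadFun]
  have hiv : ∀ v, v ≠ u → i (gen Γ v) = gen Γ v := by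
    intro v hv
    simp [hidef, whiteheadAut_gen, whiteheadFun, hv]
  have hix : i (letterVal Γ x) = letterVal Γ x := by
    unfold letterVal
    split_ifs
    · exact hiv _ hux.symm
    · rw [map_inv, hiv _ hux.symm]
  have key : toOut (i * α * i) ∈ OutL Γ := by
    refine rightTransvection_mem (u := u) (x := x.inv) hux hadj hle ?_ ?_
    · simp [MulAut.mul_apply, hiu, h1, hix, letterVal_inv]
    · intro v hv
      simp [MulAut.mul_apply, hiv v hv, h2 v hv]
  have h3 : α = i * (i * α * i) * i := by
    rw [mul_assoc i α i, ← mul_assoc i i, hsq, one_mul, mul_assoc, hsq, mul_one]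
  rw [h3, map_mul, map_mul]
  exact mul_mem (mul_mem hm key) hm

theorem sameComponent_ne {m v w : V} (h : SameComponent Γ m v w) : w ≠ m := by
  rintro rfl
  exact h.2.1 (Or.inl rfl)

theorem conj_mem {α : MulAut (RAAG Γ)} {x : Letter V} {c : V} (hc : c ∉ star Γ x.1)
    (h1 : ∀ u, SameComponent Γ x.1 c u →
      α (gen Γ u) = letterVal Γ x * gen Γ u * (letterVal Γ x)⁻¹)
    (h2 : ∀ u, ¬ SameComponent Γ x.1 c u → α (gen Γ u) = gen Γ u) :
    toOut α ∈ OutL Γ := by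
  obtain ⟨w, b⟩ := x
  cases b
  · rw [← inv_mem_iff, ← map_inv]
    refine Subgroup.subset_closure ⟨_, Or.inr (Or.inr (Or.inl ⟨w, c, hc, ?_, ?_⟩)), rfl⟩
    · intro u hu
      apply α.injective
      rw [MulAut.apply_inv_self, map_mul, map_mul, map_inv, h1 u hu,
        h2 w (fun h => sameComponent_ne h rfl)]
      simp [letterVal, mul_assoc]
    · intro v hv
      apply α.injective
      rw [MulAut.apply_inv_self, h2 v hv]
  · exact Subgroup.subset_closure
      ⟨_, Or.inr (Or.inr (Or.inl ⟨w, c, hc, by simpa [letterVal] using h1, h2⟩)), rfl⟩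

theorem mem_of_factor {P' : Set (Letter V)} (h : WhiteheadConditions Γ P m)
    (h' : WhiteheadConditions Γ P' m) (hmem : toOut (whiteheadAut h') ∈ OutL Γ)
    (hb : toOut (whiteheadAut h' * whiteheadAut h) ∈ OutL Γ) :
    toOut (whiteheadAut h) ∈ OutL Γ := by
  have h3 : whiteheadAut h = whiteheadAut h' * (whiteheadAut h' * whiteheadAut h) := by
    rw [← mul_assoc, whiteheadAut_sq, one_mul]
  rw [h3, map_mul]
  exact mul_mem hmem hb

theorem factor_fix {P' : Set (Letter V)} (h : WhiteheadConditions Γ P m)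
    (h' : WhiteheadConditions Γ P' m) {u : V} (hu : ∀ b, (u, b) ∈ P ↔ (u, b) ∈ P') :
    (whiteheadAut h' * whiteheadAut h) (gen Γ u) = gen Γ u := by
  have h1 : whiteheadAut h (gen Γ u) = whiteheadAut h' (gen Γ u) := by
    rw [whiteheadAut_gen, whiteheadAut_gen]
    have ht := hu true
    have hf := hu false
    by_cases h2 : (u, true) ∈ P' <;> by_cases h3 : (u, false) ∈ P' <;>
      simp [whiteheadFun, ht, hf, h2, h3]
  rw [MulAut.mul_apply, h1, ← MulAut.mul_apply, whiteheadAut_sq, MulAut.one_apply]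

theorem WhiteheadConditions.diff_single (h : WhiteheadConditions Γ P m) {x : Letter V}
    (hx : x.inv ∉ P) (hxm : x ≠ m) : WhiteheadConditions Γ (P \ {x}) m where
  mem := ⟨h.mem, fun h1 => hxm h1.symm⟩
  inv_notMem := fun h1 => h.inv_notMem h1.1
  not_adj := fun y hy => h.not_adj y hy.1
  le := by
    intro y hy hy'
    refine h.le y hy.1 fun h1 => hy' ⟨h1, ?_⟩
    rintro rfl
    apply hx
    simpa [Letter.inv] using hy.1
  comp := by
    intro v h1 h2 w hw
    obtain ⟨h3, h4⟩ := h.comp v h1.1 h2.1 w hw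
    refine ⟨⟨h3, ?_⟩, ⟨h4, ?_⟩⟩
    · rintro rfl; exact hx h4
    · rintro rfl; exact hx h3

theorem sameComponent_trans {m u v w : V} (h1 : SameComponent Γ m u v)
    (h2 : SameComponent Γ m v w) : SameComponent Γ m u w := by
  obtain ⟨a, b, h⟩ := h1
  obtain ⟨c, d, h'⟩ := h2
  exact ⟨a, d, h.trans h'⟩

theorem sameComponent_symm {m u v : V} (h1 : SameComponent Γ m u v) :
    SameComponent Γ m v u := by
  obtain ⟨a, b, h⟩ := h1
  exact ⟨b, a, h.symm⟩

theorem WhiteheadConditions.diff_component (h : WhiteheadConditions Γ P m) (c : V) :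
    WhiteheadConditions Γ (P \ {x | SameComponent Γ m.1 c x.1}) m where
  mem := ⟨h.mem, fun h1 => sameComponent_ne h1 rfl⟩
  inv_notMem := fun h1 => h.inv_notMem h1.1
  not_adj := fun y hy => h.not_adj y hy.1
  le := fun y hy hy' => h.le y hy.1 fun h1 => hy' ⟨h1, hy.2⟩
  comp := by
    intro v h1 h2 w hw
    obtain ⟨h3, h4⟩ := h.comp v h1.1 h2.1 w hw
    have h5 : ¬ SameComponent Γ m.1 c w := fun h6 =>
      h1.2 (sameComponent_trans h6 (sameComponent_symm hw))
    exact ⟨⟨h3, h5⟩, ⟨h4, h5⟩⟩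

theorem whiteheadAut_mem [Finite V] (h : WhiteheadConditions Γ P m) :
    toOut (whiteheadAut h) ∈ OutL Γ := by
  induction hn : P.ncard using Nat.strong_induction_on generalizing P with
  | _ n ih =>
  subst hn
  have hinv : ∀ {b : Bool}, (m.1, b) ∈ P → (m.1, b) = m := by
    intro b hb
    obtain ⟨w, b'⟩ := m
    have h2 := h.inv_notMem
    revert hb h2
    cases b <;> cases b' <;> simp +contextual [Letter.inv]
  by_cases hs : ∃ x ∈ P, x.inv ∉ P ∧ x ≠ m
  · obtain ⟨⟨u, b⟩, hx, hxi, hxm⟩ := hs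
    have h' := h.diff_single hxi hxm
    refine mem_of_factor h h' (ih _ (Set.ncard_lt_ncard ?_ (Set.toFinite _)) h' rfl) ?_
    · exact ⟨Set.sdiff_subset, fun hh => (hh hx).2 rfl⟩
    have hum : u ≠ m.1 := by rintro rfl; exact hxm (hinv hx)
    have hfix : ∀ v, v ≠ u →
        (whiteheadAut h' * whiteheadAut h) (gen Γ v) = gen Γ v := by
      intro v hv
      apply factor_fix
      intro b'
      simp [hv]
    have hle := h.le _ hx hxi
    have hna := h.not_adj _ hx
    have hm := whiteheadAut_m h'
    cases b
    · refine leftTransvection_mem (x := m.inv) hum hna hle ?_ hfix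
      simp only [Letter.inv, Bool.not_false] at hxi
      rw [MulAut.mul_apply, whiteheadAut_gen]
      simp [whiteheadFun, hum, hx, hxi, hm, whiteheadAut_gen, letterVal_inv]
    · refine rightTransvection_mem (x := m) hum hna hle ?_ hfix
      simp only [Letter.inv, Bool.not_true] at hxi
      rw [MulAut.mul_apply, whiteheadAut_gen]
      simp [whiteheadFun, hum, hx, hxi, hm, whiteheadAut_gen]
  by_cases hd : ∃ c, (c, true) ∈ P ∧ (c, false) ∈ P
  · obtain ⟨c, hc1, hc2⟩ := hd
    have hcm : c ≠ m.1 := by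
      rintro rfl
      have h1 := (hinv hc1).trans (hinv hc2).symm
      simp at h1
    have hcs : c ∈ (star Γ m.1)ᶜ := by
      rintro (h1 | h1)
      · exact hcm h1
      · exact h.not_adj _ hc1 (Γ.adj_symm h1)
    have h' := h.diff_component c
    have hcc : SameComponent Γ m.1 c c := ⟨hcs, hcs, SimpleGraph.Reachable.refl _⟩
    refine mem_of_factor h h' (ih _ (Set.ncard_lt_ncard ?_ (Set.toFinite _)) h' rfl) ?_
    · exact ⟨Set.sdiff_subset, fun hh => (hh hc1).2 hcc⟩
    have hm := whiteheadAut_m h'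
    refine conj_mem (x := m.inv) (c := c) hcs ?_ ?_
    · intro u hu
      obtain ⟨h1, h2⟩ := h.comp c hc1 hc2 u hu
      have hu' : SameComponent Γ m.1 c u := hu
      have hum : u ≠ m.1 := sameComponent_ne hu
      rw [MulAut.mul_apply, whiteheadAut_gen]
      simp [whiteheadFun, hum, h1, h2, hm, whiteheadAut_gen, letterVal_inv, hu']
    · intro u hu
      apply factor_fix
      intro b
      have hu' : ¬ SameComponent Γ m.1 c u := hu
      simp [hu']
  · have hP : P = {m} := by
      refine Set.eq_singleton_iff_unique_mem.2 ⟨h.mem, ?_⟩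
      rintro ⟨u, b⟩ hx
      by_contra hne
      have hi : Letter.inv (u, b) ∈ P := by
        by_contra hi
        exact hs ⟨_, hx, hi, hne⟩
      cases b
      · exact hd ⟨u, hi, hx⟩
      · exact hd ⟨u, hx, hi⟩
    subst hP
    exact inversion_mem (inversion_isInversion Γ m)

/-- The long-range outer automorphism represented by the Whitehead automorphism `(P, m)`. -/
noncomputable def whiteheadOut [Finite V] (h : IsWhiteheadPair Γ P m) : OutL Γ :=
  ⟨toOut (whiteheadAut h.toWhiteheadConditions), whiteheadAut_mem h.toWhiteheadConditions⟩

end Pairs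

/-! ### Marked Salvettis, their norm, and Whitehead paths -/

section Salvetti

variable {V : Type*} (Γ : SimpleGraph V)

/-- Marked Salvettis. Homotopy classes of self-homotopy equivalences of the (aspherical) Salvetti
complex `𝕊` are outer automorphisms of `A_Γ`; a marking `(𝕊, φ)` is an element `φ` of `OutL Γ`,
and `(𝕊, φ)`, `(𝕊, φ')` are equivalent iff `φ = φ' h` for some `h` represented by an
isomorphism of `𝕊`. -/
abbrev MarkedSalvetti : Type _ := OutL Γ ⧸ (signedSymm Γ).subgroupOf (OutL Γ)

/-- The marked Salvetti `(𝕊, φ)`. -/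
def MarkedSalvetti.mk (φ : OutL Γ) : MarkedSalvetti Γ := QuotientGroup.mk φ

/-- The minimal length of a word in `V^±` representing an element of the conjugacy class. -/
noncomputable def conjLength (c : ConjClasses (RAAG Γ)) : ℕ :=
  sInf {n | ∃ w : List (Letter V), ConjClasses.mk (wordVal Γ w) = c ∧ w.length = n}

/-- The set of conjugacy classes represented by words of length at most two. -/
def shortClasses : Set (ConjClasses (RAAG Γ)) :=
  {c | ∃ w : List (Letter V), w.length ≤ 2 ∧ ConjClasses.mk (wordVal Γ w) = c}

theorem shortClasses_finite [Finite V] : (shortClasses Γ).Finite := by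
  have h : shortClasses Γ ⊆ (fun w => ConjClasses.mk (wordVal Γ w)) ''
      {w : List (Letter V) | w.length ≤ 2} := by
    rintro c ⟨w, hw, rfl⟩
    exact ⟨w, hw, rfl⟩
  exact ((List.finite_length_le (Letter V) 2).image _).subset h

/-- The length `ℓ_σ(g)` for `σ = (𝕊, φ)`. -/
noncomputable def markedLength (φ : OutL Γ) (g : ConjClasses (RAAG Γ)) : ℕ :=
  conjLength Γ (outConj (φ : Out (RAAG Γ))⁻¹ g)

theorem conjLength_le_of_letters {α : MulAut (RAAG Γ)}
    (h : ∀ x : Letter V, ∃ y : Letter V, α (letterVal Γ x) = letterVal Γ y)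
    (c : ConjClasses (RAAG Γ)) : conjLength Γ (outConj (toOut α) c) ≤ conjLength Γ c := by
  choose f hf using h
  have hne : {n | ∃ w : List (Letter V), ConjClasses.mk (wordVal Γ w) = c ∧
      w.length = n}.Nonempty := by
    obtain ⟨a, rfl⟩ := ConjClasses.exists_rep c
    obtain ⟨w, rfl⟩ := exists_word Γ a
    exact ⟨_, w, rfl, rfl⟩
  obtain ⟨w, hw, hl⟩ := Nat.sInf_mem hne
  refine Nat.sInf_le ⟨w.map f, ?_, by rw [List.length_map, hl]; rfl⟩
  rw [← hw, outConj_toOut]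
  congr 1
  simp [wordVal, map_list_prod, Function.comp_def, hf]

theorem conjLength_signedSymm {h : Out (RAAG Γ)} (hh : h ∈ signedSymm Γ)
    (c : ConjClasses (RAAG Γ)) : conjLength Γ (outConj h c) = conjLength Γ c := by
  have cancel : ∀ (β : Out (RAAG Γ)) (d : ConjClasses (RAAG Γ)),
      outConj β (outConj β⁻¹ d) = d := by
    intro β d
    rw [← Equiv.Perm.mul_apply, ← map_mul, mul_inv_cancel, map_one, Equiv.Perm.one_apply]
  have lift : ∀ {α : MulAut (RAAG Γ)},
      (∀ v, ∃ y : Letter V, α (gen Γ v) = letterVal Γ y) →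
      ∀ x : Letter V, ∃ y : Letter V, α (letterVal Γ x) = letterVal Γ y := by
    intro α hα x
    obtain ⟨y, hy⟩ := hα x.1
    unfold letterVal
    split_ifs
    · exact ⟨y, hy⟩
    · refine ⟨y.inv, ?_⟩
      change α _ = letterVal Γ y.inv
      rw [map_inv, hy, letterVal_inv]
  induction hh using Subgroup.closure_induction generalizing c with
  | one => rw [map_one, Equiv.Perm.one_apply]
  | mul x y _ _ hx hy => rw [map_mul, Equiv.Perm.mul_apply, hx, hy]
  | inv x _ hx => rw [← hx, cancel]
  | mem x hx =>
    obtain ⟨α, hα, rfl⟩ := hx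
    have h1 : ∀ v, ∃ y : Letter V, α (gen Γ v) = letterVal Γ y := by
      rcases hα with ⟨f, hf⟩ | ⟨u, hu, hf⟩
      · exact fun v => ⟨(f v, true), by simp [hf, letterVal]⟩
      · intro v
        by_cases hv : v = u
        · exact ⟨(u, false), by simp [hv, hu, letterVal]⟩
        · exact ⟨(v, true), by simp [hf v hv, letterVal]⟩
    have h2 : ∀ v, ∃ y : Letter V, α⁻¹ (gen Γ v) = letterVal Γ y := by
      rcases hα with ⟨f, hf⟩ | ⟨u, hu, hf⟩
      · intro v
        refine ⟨(f.symm v, true), α.injective ?_⟩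
        rw [MulAut.apply_inv_self]
        simp [letterVal, hf]
      · intro v
        by_cases hv : v = u
        · refine ⟨(u, false), α.injective ?_⟩
          rw [MulAut.apply_inv_self]
          simp [letterVal, hv, hu]
        · refine ⟨(v, true), α.injective ?_⟩
          rw [MulAut.apply_inv_self]
          simp [letterVal, hf v hv]
    refine le_antisymm (conjLength_le_of_letters Γ (lift h1) c) ?_
    have h3 := conjLength_le_of_letters Γ (lift h2) (outConj (toOut α) c)
    have h4 : outConj (toOut α⁻¹) (outConj (toOut α) c) = c := by
      have := cancel (toOut α)⁻¹ c
      rwa [inv_inv, ← map_inv] at this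
    rwa [h4] at h3

theorem markedLength_eq {φ ψ : OutL Γ}
    (h : MarkedSalvetti.mk Γ φ = MarkedSalvetti.mk Γ ψ) (g : ConjClasses (RAAG Γ)) :
    markedLength Γ φ g = markedLength Γ ψ g := by
  have h1 : φ⁻¹ * ψ ∈ (signedSymm Γ).subgroupOf (OutL Γ) := QuotientGroup.eq.1 h
  rw [Subgroup.mem_subgroupOf] at h1
  have h2 := conjLength_signedSymm Γ h1 (outConj (ψ : Out (RAAG Γ))⁻¹ g)
  rw [← Equiv.Perm.mul_apply, ← map_mul] at h2
  simpa [markedLength] using h2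

variable [Finite V]

/-- The first coordinate `‖σ‖₀ = ∑_{g ∈ 𝒢₀} ℓ_σ(g)` of the norm of a marked Salvetti `σ`. -/
noncomputable def normZero (σ : MarkedSalvetti Γ) : ℕ :=
  Quotient.lift (fun φ : OutL Γ => ∑ g ∈ (shortClasses_finite Γ).toFinset, markedLength Γ φ g)
    (fun _ _ h => Finset.sum_congr rfl fun g _ => markedLength_eq Γ (Quotient.sound h) g) σ

variable {Γ}

/-- The result `σ^P_m = (𝕊, φ ∘ (P, m))` of the Whitehead move associated to `(P, m)` at
`σ = (𝕊, φ)`. -/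
noncomputable def whiteheadMove (φ : OutL Γ) {P : Set (Letter V)} {m : Letter V}
    (h : IsWhiteheadPair Γ P m) : MarkedSalvetti Γ :=
  MarkedSalvetti.mk Γ (φ * whiteheadOut h)

/-- `τ'` is the result of a Whitehead move at `τ`. -/
def IsWhiteheadMove (τ τ' : MarkedSalvetti Γ) : Prop :=
  ∃ (φ : OutL Γ) (P : Set (Letter V)) (m : Letter V) (h : IsWhiteheadPair Γ P m),
    τ = MarkedSalvetti.mk Γ φ ∧ τ' = whiteheadMove φ h

/-- `τ 0, τ 1, …, τ k` is a Whitehead path from `σ` to `σ'`: consecutive terms are joined by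
Whitehead moves. -/
structure IsWhiteheadPath (σ σ' : MarkedSalvetti Γ) (k : ℕ) (τ : ℕ → MarkedSalvetti Γ) :
    Prop where
  start : τ 0 = σ
  finish : τ k = σ'
  move : ∀ i < k, IsWhiteheadMove (τ i) (τ (i + 1))

end Salvetti

end WhiteheadRAAG

namespace WhiteheadRAAG

/-! ### Reduced words in right-angled Artin groups -/

section Words

variable {V : Type*} {Γ : SimpleGraph V}

/-! A Whitehead automorphism based at `m` changes only the number of letters `m`, `m⁻¹` in a reduced
word, and the new number is geometric: it counts how often the word crosses a wall dual to `P` in a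
blow-up of the Salvetti complex (`WhiteheadConditions.wordLength_aut`). Letter counts and crossing
numbers are both minimized by reduced words (`IsCost.le_of_reduced`), so they can be compared on a
single reduced word. The length of a conjugacy class is a stable word length
(`exists_bound_wordLength_pow`); hence additive inequalities between word lengths pass to conjugacy
classes and, by summation, to ‖·‖₀.

Two such inequalities carry the argument. Along a square of Whitehead automorphisms with bases on
distinct vertices, lengths are additive (`wordLength_square`), so the corner opposite σ has norm at
most ‖σ^P_v‖₀ + ‖σ^Q_w‖₀ − ‖σ‖₀ < ‖σ‖₀. And crossing numbers are submodular: if `v ∉ Q`, `w ∉ P` and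
the bases are not adjacent, the norms for `P \ Q` and `Q \ P` add up to at most those for `P` and
`Q` (`wordLength_diff_add_le`), so one of them lies below ‖σ‖₀.

Adjacent bases give a square. Otherwise each side may be replaced by its complement, which changes
the automorphism by an inner one (`WhiteheadConditions.aut_compl`). Usually this achieves `v ∉ Q`
and `w ∉ P`; uncrossing `P` and `Q` then leads to disjoint sides. For these there is a single move
(inverse bases), a square, or, if each side separates the other's base from its inverse, an exchange
of bases, the links of the two bases being equal. In the remaining configuration each quadrant cut
out by `P` and `Q` contains exactly one of `v`, `v⁻¹`, `w`, `w⁻¹`; the links again agree, and the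
norms of the four quadrants add up to at most 2(‖σ^P_v‖₀ + ‖σ^Q_w‖₀) < 4‖σ‖₀, so some quadrant
supplies the detour. -/

@[simp] theorem Letter.inv_inv (x : Letter V) : x.inv.inv = x := by
  simp [Letter.inv]

@[simp] theorem Letter.inv_fst (x : Letter V) : x.inv.1 = x.1 := rfl

theorem Letter.inv_ne (x : Letter V) : x.inv ≠ x := by
  intro h
  have := congrArg Prod.snd h
  simp [Letter.inv] at this

theorem Letter.eq_or_eq_inv {x y : Letter V} (h : x.1 = y.1) : x = y ∨ x = y.inv := by
  obtain ⟨a, b⟩ := x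
  obtain ⟨c, d⟩ := y
  cases b <;> cases d <;> simp_all [Letter.inv]

@[simp] theorem wordVal_nil : wordVal Γ [] = 1 := rfl

@[simp] theorem wordVal_cons (x : Letter V) (w : List (Letter V)) :
    wordVal Γ (x :: w) = letterVal Γ x * wordVal Γ w := by
  simp [wordVal]

@[simp] theorem wordVal_append (w u : List (Letter V)) :
    wordVal Γ (w ++ u) = wordVal Γ w * wordVal Γ u := by
  simp [wordVal]

theorem letterVal_comm {x y : Letter V} (h : Γ.Adj x.1 y.1) :
    letterVal Γ x * letterVal Γ y = letterVal Γ y * letterVal Γ x := by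
  have h1 : Commute (gen Γ x.1) (letterVal Γ y) := letterVal_commute h
  change Commute (letterVal Γ x) (letterVal Γ y)
  rw [letterVal]
  split_ifs
  · exact h1
  · exact h1.inv_left

/-! ### Moving a letter to the front of a word. -/

/-- `Extract Γ y t u`: the word `u` is obtained from `t` by removing an occurrence of `y` all
of whose predecessors in `t` are adjacent to `y`. -/
inductive Extract (Γ : SimpleGraph V) (y : Letter V) :
    List (Letter V) → List (Letter V) → Prop
  | head (t : List (Letter V)) : Extract Γ y (y :: t) t
  | cons {z : Letter V} {t u : List (Letter V)} :
      Γ.Adj y.1 z.1 → Extract Γ y t u → Extract Γ y (z :: t) (z :: u)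

theorem Extract.unique {y : Letter V} {t u u' : List (Letter V)} (h : Extract Γ y t u)
    (h' : Extract Γ y t u') : u = u' := by
  induction h generalizing u' with
  | head t =>
    cases h' with
    | head => rfl
    | cons ha _ => exact absurd ha (Γ.loopless.irrefl _)
  | cons ha _ ih =>
    cases h' with
    | head => exact absurd ha (Γ.loopless.irrefl _)
    | cons _ h2 => rw [ih h2]

theorem Extract.cons_iff {y z : Letter V} {t v : List (Letter V)} (h : Γ.Adj y.1 z.1) :
    Extract Γ y (z :: t) v ↔ ∃ u, v = z :: u ∧ Extract Γ y t u := by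
  constructor
  · intro h1
    cases h1 with
    | head => exact absurd h (Γ.loopless.irrefl _)
    | cons _ h2 => exact ⟨_, rfl, h2⟩
  · rintro ⟨u, rfl, h2⟩
    exact h2.cons h

theorem Extract.wordVal {y : Letter V} {t u : List (Letter V)} (h : Extract Γ y t u) :
    wordVal Γ t = letterVal Γ y * wordVal Γ u := by
  induction h with
  | head t => simp
  | cons ha _ ih => simp only [wordVal_cons, ih, ← mul_assoc, letterVal_comm ha]

theorem Extract.length {y : Letter V} {t u : List (Letter V)} (h : Extract Γ y t u) :
    t.length = u.length + 1 := by
  induction h with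
  | head t => simp
  | cons ha _ ih => simp [ih]

theorem Extract.append_right {y : Letter V} {t u : List (Letter V)} (h : Extract Γ y t u)
    (q : List (Letter V)) : Extract Γ y (t ++ q) (u ++ q) := by
  induction h with
  | head t => exact .head _
  | cons ha _ ih => exact ih.cons ha

theorem Extract.of_append {y : Letter V} {p q u : List (Letter V)} (h : Extract Γ y (p ++ q) u) :
    (∃ u', Extract Γ y p u') ∨ (∀ z ∈ p, Γ.Adj y.1 z.1) ∧ ∃ u', Extract Γ y q u' := by
  induction p generalizing u with
  | nil => exact Or.inr ⟨by simp, u, h⟩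
  | cons z p ih =>
    cases h with
    | head => exact Or.inl ⟨_, .head _⟩
    | cons ha h2 =>
      rcases ih h2 with ⟨u', hu⟩ | ⟨h3, h4⟩
      · exact Or.inl ⟨_, hu.cons ha⟩
      · refine Or.inr ⟨?_, h4⟩
        intro x hx
        rcases List.mem_cons.1 hx with rfl | hx
        · exact ha
        · exact h3 x hx

theorem Extract.append_left {y : Letter V} {p q u : List (Letter V)}
    (hp : ∀ z ∈ p, Γ.Adj y.1 z.1) (h : Extract Γ y q u) : Extract Γ y (p ++ q) (p ++ u) := by
  induction p with
  | nil => exact h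
  | cons z p ih =>
    exact (ih fun x hx => hp x (List.mem_cons_of_mem _ hx)).cons (hp z List.mem_cons_self)

/-- Since `z` commutes with `y`, removing `y` cannot be what allows `z` to reach the front. -/
theorem Extract.pullback {y z : Letter V} {t u u' : List (Letter V)} (hyz : Γ.Adj y.1 z.1)
    (h : Extract Γ y t u) (h' : Extract Γ z u u') : ∃ t', Extract Γ z t t' := by
  induction h generalizing u' with
  | head t => exact ⟨_, h'.cons hyz.symm⟩
  | cons ha _ ih =>
    cases h' with
    | head => exact ⟨_, .head _⟩
    | cons hb h2 =>
      obtain ⟨t', ht⟩ := ih h2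
      exact ⟨_, ht.cons hb⟩

theorem Extract.diamond {y z : Letter V} {t u u' : List (Letter V)} (hyz : Γ.Adj y.1 z.1)
    (h : Extract Γ y t u) (h' : Extract Γ z t u') :
    ∃ s, Extract Γ z u s ∧ Extract Γ y u' s := by
  induction h generalizing u' with
  | head t =>
    obtain ⟨s, rfl, hs⟩ := (Extract.cons_iff hyz.symm).1 h'
    exact ⟨s, hs, .head _⟩
  | cons ha h1 ih =>
    cases h' with
    | head => exact ⟨_, .head _, h1⟩
    | cons hb h2 =>
      obtain ⟨s, hs, hs'⟩ := ih h2
      exact ⟨_, hs.cons hb, hs'.cons ha⟩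

/-! ### Trace equivalence. -/

open Classical in
/-- Two words are trace equivalent if they have the same projections to all pairs of letters
on non-adjacent vertices. -/
def TraceEq (Γ : SimpleGraph V) (w w' : List (Letter V)) : Prop :=
  ∀ a b : Letter V, ¬ Γ.Adj a.1 b.1 →
    w.filter (fun x => x = a ∨ x = b) = w'.filter (fun x => x = a ∨ x = b)

theorem TraceEq.refl (w : List (Letter V)) : TraceEq Γ w w := fun _ _ _ => rfl

theorem TraceEq.symm {w w' : List (Letter V)} (h : TraceEq Γ w w') : TraceEq Γ w' w :=
  fun a b hab => (h a b hab).symm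

theorem TraceEq.trans {w w' w'' : List (Letter V)} (h : TraceEq Γ w w')
    (h' : TraceEq Γ w' w'') : TraceEq Γ w w'' :=
  fun a b hab => (h a b hab).trans (h' a b hab)

theorem TraceEq.cons_iff {x : Letter V} {w w' : List (Letter V)} :
    TraceEq Γ (x :: w) (x :: w') ↔ TraceEq Γ w w' := by
  unfold TraceEq
  refine forall_congr' fun a => forall_congr' fun b => imp_congr_right fun _ => ?_
  by_cases h : x = a ∨ x = b <;> simp [h]

theorem TraceEq.swap {x y : Letter V} (h : Γ.Adj x.1 y.1) (w : List (Letter V)) :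
    TraceEq Γ (x :: y :: w) (y :: x :: w) := by
  intro a b hab
  by_cases hx : x = a ∨ x = b
  · by_cases hy : y = a ∨ y = b
    · rcases hx with rfl | rfl <;> rcases hy with rfl | rfl
      · rfl
      · exact absurd h hab
      · exact absurd h.symm hab
      · rfl
    · simp [List.filter_cons, hy]
  · simp [List.filter_cons, hx]

theorem Extract.traceEq {y : Letter V} {t u : List (Letter V)} (h : Extract Γ y t u) :
    TraceEq Γ t (y :: u) := by
  induction h with
  | head t => exact .refl _
  | cons ha _ ih => exact (TraceEq.cons_iff.2 ih).trans (TraceEq.swap ha.symm _)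

/-- A letter `y` can be brought to the front as soon as it comes first in each projection to `y` and
a letter that does not commute with it. Projections turn this into a condition that an induction on
the word can check. -/
theorem TraceEq.exists_extract {y : Letter V} {t u : List (Letter V)}
    (h : TraceEq Γ t (y :: u)) : ∃ u', Extract Γ y t u' ∧ TraceEq Γ u' u := by
  classical
  suffices hs : ∃ u', Extract Γ y t u' by
    obtain ⟨u', hu⟩ := hs
    exact ⟨u', hu, TraceEq.cons_iff.1 (hu.traceEq.symm.trans h)⟩
  have key : ∀ b : Letter V, ¬ Γ.Adj y.1 b.1 →
      ∃ r, t.filter (fun x => x = y ∨ x = b) = y :: r := by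
    intro b hb
    refine ⟨u.filter (fun x => x = y ∨ x = b), ?_⟩
    convert h y b hb using 1
    simp
  clear h
  induction t with
  | nil =>
    obtain ⟨r, hr⟩ := key y (Γ.loopless.irrefl _)
    simp at hr
  | cons z t ih =>
    by_cases hz : z = y
    · subst hz; exact ⟨_, .head _⟩
    by_cases ha : Γ.Adj y.1 z.1
    · obtain ⟨u', hu⟩ := ih (by
        intro b hb
        obtain ⟨r, hr⟩ := key b hb
        have hzb : z ≠ b := by rintro rfl; exact hb ha
        exact ⟨r, by simpa [List.filter_cons, hz, hzb] using hr⟩)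
      exact ⟨_, hu.cons ha⟩
    -- A non-commuting `z` in front of `y` would also come first in the projection to `y` and `z`.
    · obtain ⟨r, hr⟩ := key z ha
      simp [hz] at hr

theorem TraceEq.extract {x : Letter V} {w w' u : List (Letter V)} (h : TraceEq Γ w w')
    (hu : Extract Γ x w u) : ∃ u', Extract Γ x w' u' ∧ TraceEq Γ u u' := by
  obtain ⟨u', h1, h2⟩ := (h.symm.trans hu.traceEq).exists_extract
  exact ⟨u', h1, h2.symm⟩

theorem TraceEq.eq_nil {w : List (Letter V)} (h : TraceEq Γ [] w) : w = [] := by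
  cases w with
  | nil => rfl
  | cons x w =>
    obtain ⟨u', hu, _⟩ := h.exists_extract
    cases hu

/-! ### Reduced words and the action of the group on their trace classes. -/

/-- A word is reduced if no letter can be moved next to an inverse of it. -/
def Reduced (Γ : SimpleGraph V) : List (Letter V) → Prop
  | [] => True
  | x :: w => Reduced Γ w ∧ ∀ u, ¬ Extract Γ x.inv w u

theorem Reduced.extract {y : Letter V} {t u : List (Letter V)} (ht : Reduced Γ t)
    (h : Extract Γ y t u) : Reduced Γ u := by
  induction h with
  | head t => exact ht.1
  | cons ha h1 ih =>
    refine ⟨ih ht.1, fun u' hu' => ?_⟩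
    obtain ⟨t', ht'⟩ := h1.pullback (z := Letter.inv _) ha hu'
    exact ht.2 _ ht'

theorem Reduced.not_extract {y : Letter V} {t u s : List (Letter V)} (ht : Reduced Γ t)
    (h : Extract Γ y t u) (h' : Extract Γ y.inv u s) : False := by
  induction h generalizing s with
  | head t => exact ht.2 _ h'
  | cons ha h1 ih =>
    obtain ⟨s', rfl, hs⟩ := (Extract.cons_iff (y := y.inv) ha).1 h'
    exact ih ht.1 hs

open Classical in
/-- Multiplication of a reduced word by a letter on the left. -/
noncomputable def push (Γ : SimpleGraph V) (x : Letter V) (w : List (Letter V)) :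
    List (Letter V) :=
  if h : ∃ u, Extract Γ x.inv w u then h.choose else x :: w

theorem push_of_extract {x : Letter V} {w u : List (Letter V)} (h : Extract Γ x.inv w u) :
    push Γ x w = u := by
  have h' : ∃ u, Extract Γ x.inv w u := ⟨u, h⟩
  rw [push, dif_pos h']
  exact h'.choose_spec.unique h

theorem push_of_not {x : Letter V} {w : List (Letter V)} (h : ∀ u, ¬ Extract Γ x.inv w u) :
    push Γ x w = x :: w :=
  dif_neg fun ⟨u, hu⟩ => h u hu

theorem Reduced.push {w : List (Letter V)} (h : Reduced Γ w) (x : Letter V) :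
    Reduced Γ (push Γ x w) := by
  by_cases hx : ∃ u, Extract Γ x.inv w u
  · obtain ⟨u, hu⟩ := hx
    rw [push_of_extract hu]
    exact h.extract hu
  · push Not at hx
    rw [push_of_not hx]
    exact ⟨h, hx⟩

theorem TraceEq.push {w w' : List (Letter V)} (h : TraceEq Γ w w') (x : Letter V) :
    TraceEq Γ (push Γ x w) (push Γ x w') := by
  by_cases hx : ∃ u, Extract Γ x.inv w u
  · obtain ⟨u, hu⟩ := hx
    obtain ⟨u', hu', he⟩ := h.extract hu
    rwa [push_of_extract hu, push_of_extract hu']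
  · push Not at hx
    rw [push_of_not hx, push_of_not, TraceEq.cons_iff]
    · exact h
    · intro u' hu'
      obtain ⟨u, hu, _⟩ := h.symm.extract hu'
      exact hx u hu

theorem push_inv_push {w : List (Letter V)} (h : Reduced Γ w) (x : Letter V) :
    TraceEq Γ (push Γ x.inv (push Γ x w)) w := by
  by_cases hx : ∃ u, Extract Γ x.inv w u
  · obtain ⟨u, hu⟩ := hx
    rw [push_of_extract hu, push_of_not fun s hs => h.not_extract hu hs]
    exact hu.traceEq.symm
  · push Not at hx
    rw [push_of_not hx, push_of_extract (u := w)]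
    · exact .refl _
    · rw [Letter.inv_inv]
      exact .head _

/-- This is the defining relation for the action on trace classes: adjacent vertices act by
commuting permutations. Each of the two letters cancels or not independently of the other. -/
theorem push_comm {x y : Letter V} (hxy : Γ.Adj x.1 y.1) (w : List (Letter V)) :
    TraceEq Γ (push Γ x (push Γ y w)) (push Γ y (push Γ x w)) := by
  have mixed : ∀ {x y : Letter V} {u : List (Letter V)}, Γ.Adj x.1 y.1 → Extract Γ x.inv w u →
      (∀ u, ¬ Extract Γ y.inv w u) → push Γ x (push Γ y w) = push Γ y (push Γ x w) := by
    intro x y u hxy hu hy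
    rw [push_of_extract hu, push_of_not hy, push_of_extract (u := y :: u), push_of_not]
    · intro s hs
      obtain ⟨t, ht⟩ := hu.pullback (y := x.inv) (z := y.inv) hxy hs
      exact hy t ht
    · exact hu.cons hxy
  by_cases hx : ∃ u, Extract Γ x.inv w u <;> by_cases hy : ∃ u, Extract Γ y.inv w u
  · obtain ⟨u, hu⟩ := hx
    obtain ⟨u', hu'⟩ := hy
    obtain ⟨s, hs, hs'⟩ := hu.diamond (y := x.inv) (z := y.inv) hxy hu'
    rw [push_of_extract hu, push_of_extract hu', push_of_extract hs, push_of_extract hs']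
    exact .refl _
  · obtain ⟨u, hu⟩ := hx
    push Not at hy
    rw [mixed hxy hu hy]
    exact .refl _
  · obtain ⟨u, hu⟩ := hy
    push Not at hx
    rw [mixed hxy.symm hu hx]
    exact .refl _
  · push Not at hx hy
    rw [push_of_not hx, push_of_not hy, push_of_not, push_of_not]
    · exact TraceEq.swap hxy w
    · intro s hs
      obtain ⟨u, _, hu⟩ := (Extract.cons_iff (y := y.inv) hxy.symm).1 hs
      exact hy u hu
    · intro s hs
      obtain ⟨u, _, hu⟩ := (Extract.cons_iff (y := x.inv) hxy).1 hs
      exact hx u hu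

/-- Trace equivalence of reduced words. -/
def traceSetoid (Γ : SimpleGraph V) : Setoid {w : List (Letter V) // Reduced Γ w} where
  r w w' := TraceEq Γ w.1 w'.1
  iseqv := ⟨fun _ => .refl _, fun h => h.symm, fun h h' => h.trans h'⟩

/-- The action of a letter on the trace classes of reduced words. -/
noncomputable def pushClass (Γ : SimpleGraph V) (x : Letter V) :
    Quotient (traceSetoid Γ) → Quotient (traceSetoid Γ) :=
  Quotient.map (fun w => ⟨push Γ x w.1, w.2.push x⟩) fun _ _ h => TraceEq.push h x

theorem pushClass_inv (x : Letter V) (c : Quotient (traceSetoid Γ)) :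
    pushClass Γ x.inv (pushClass Γ x c) = c := by
  induction c using Quotient.inductionOn with
  | h w => exact Quotient.sound (push_inv_push w.2 x)

/-- The permutation by which a generator acts on the trace classes of reduced words. -/
noncomputable def pushPerm (Γ : SimpleGraph V) (v : V) :
    Equiv.Perm (Quotient (traceSetoid Γ)) where
  toFun := pushClass Γ (v, true)
  invFun := pushClass Γ (v, false)
  left_inv := pushClass_inv (v, true)
  right_inv := pushClass_inv (v, false)

/-- The action of `A_Γ` on the trace classes of reduced words. -/
noncomputable def pushHom (Γ : SimpleGraph V) :
    RAAG Γ →* Equiv.Perm (Quotient (traceSetoid Γ)) :=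
  PresentedGroup.toGroup (f := pushPerm Γ) (by
    rintro r ⟨v, w, hvw, rfl⟩
    have h1 : pushPerm Γ v * pushPerm Γ w = pushPerm Γ w * pushPerm Γ v := by
      ext c
      induction c using Quotient.inductionOn with
      | h u => exact Quotient.sound (push_comm (x := (v, true)) (y := (w, true)) hvw u.1)
    simp [h1])

theorem pushHom_letterVal (x : Letter V) (c : Quotient (traceSetoid Γ)) :
    pushHom Γ (letterVal Γ x) c = pushClass Γ x c := by
  have h : ∀ v, pushHom Γ (gen Γ v) = pushPerm Γ v := fun v => PresentedGroup.toGroup.of _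
  obtain ⟨v, b⟩ := x
  cases b
  · simp only [letterVal, Bool.false_eq_true, if_false, map_inv, h]
    rfl
  · simp only [letterVal, if_true, h]
    rfl

/-- A reduced word representing the same element as a given word. -/
noncomputable def normalForm (Γ : SimpleGraph V) : List (Letter V) → List (Letter V)
  | [] => []
  | x :: w => push Γ x (normalForm Γ w)

theorem reduced_normalForm (w : List (Letter V)) : Reduced Γ (normalForm Γ w) := by
  induction w with
  | nil => trivial
  | cons x w ih => exact ih.push x

theorem wordVal_push (x : Letter V) (w : List (Letter V)) :
    wordVal Γ (push Γ x w) = letterVal Γ x * wordVal Γ w := by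
  by_cases hx : ∃ u, Extract Γ x.inv w u
  · obtain ⟨u, hu⟩ := hx
    rw [push_of_extract hu, hu.wordVal, letterVal_inv, mul_inv_cancel_left]
  · push Not at hx
    rw [push_of_not hx, wordVal_cons]

theorem wordVal_normalForm (w : List (Letter V)) :
    wordVal Γ (normalForm Γ w) = wordVal Γ w := by
  induction w with
  | nil => rfl
  | cons x w ih => rw [normalForm, wordVal_push, ih, wordVal_cons]

theorem Reduced.normalForm_eq {w : List (Letter V)} (h : Reduced Γ w) : normalForm Γ w = w := by
  induction w with
  | nil => rfl
  | cons x w ih => rw [normalForm, ih h.1, push_of_not h.2]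

/-- Van der Waerden's trick: the image of the empty word under a group element records its normal
form, so the normal form is determined up to trace equivalence by the group element. -/
theorem pushHom_wordVal (w : List (Letter V)) :
    pushHom Γ (wordVal Γ w) (Quotient.mk (traceSetoid Γ) ⟨[], trivial⟩) =
      Quotient.mk (traceSetoid Γ) ⟨normalForm Γ w, reduced_normalForm w⟩ := by
  induction w with
  | nil => rw [wordVal_nil, map_one]; rfl
  | cons x w ih =>
    rw [wordVal_cons, map_mul, Equiv.Perm.mul_apply, ih, pushHom_letterVal]
    rfl

theorem traceEq_normalForm {w w' : List (Letter V)} (h : wordVal Γ w = wordVal Γ w') :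
    TraceEq Γ (normalForm Γ w) (normalForm Γ w') := by
  have h1 := pushHom_wordVal (Γ := Γ) w
  rw [h, pushHom_wordVal] at h1
  exact (Quotient.exact h1).symm

/-! ### Costs and their minimization by reduced words. -/

/-- A function of words that is invariant under exchanging neighbouring letters on adjacent
vertices and does not increase under cancellation. -/
structure IsCost (Γ : SimpleGraph V) (f : List (Letter V) → ℕ) : Prop where
  swap : ∀ (p q : List (Letter V)) (x y : Letter V), Γ.Adj x.1 y.1 →
    f (p ++ x :: y :: q) = f (p ++ y :: x :: q)
  cancel : ∀ (p q : List (Letter V)) (x : Letter V), f (p ++ q) ≤ f (p ++ x :: x.inv :: q)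

theorem IsCost.extract {f : List (Letter V) → ℕ} (hf : IsCost Γ f) {y : Letter V}
    {t u : List (Letter V)} (h : Extract Γ y t u) (p : List (Letter V)) :
    f (p ++ t) = f (p ++ y :: u) := by
  induction h generalizing p with
  | head t => rfl
  | @cons z t u ha _ ih =>
    have := ih (p ++ [z])
    simp only [List.append_assoc, List.singleton_append] at this
    rw [this, hf.swap _ _ _ _ ha.symm]

theorem IsCost.traceEq {f : List (Letter V) → ℕ} (hf : IsCost Γ f) {t t' : List (Letter V)}
    (h : TraceEq Γ t t') (p : List (Letter V)) : f (p ++ t) = f (p ++ t') := by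
  induction t' generalizing t p with
  | nil => rw [h.symm.eq_nil]
  | cons y u ih =>
    obtain ⟨u', hu, he⟩ := h.exists_extract
    have := ih he (p ++ [y])
    simp only [List.append_assoc, List.singleton_append] at this
    rw [hf.extract hu, this]

theorem IsCost.push_le {f : List (Letter V) → ℕ} (hf : IsCost Γ f) (x : Letter V)
    (p w : List (Letter V)) : f (p ++ push Γ x w) ≤ f (p ++ x :: w) := by
  by_cases hx : ∃ u, Extract Γ x.inv w u
  · obtain ⟨u, hu⟩ := hx
    have := hf.extract hu (p ++ [x])
    simp only [List.append_assoc, List.singleton_append] at this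
    rw [push_of_extract hu, this]
    exact hf.cancel p u x
  · push Not at hx
    rw [push_of_not hx]

/-- Normal forms are built from the right; the prefix `p` holds the letters not yet processed. -/
theorem IsCost.normalForm_le {f : List (Letter V) → ℕ} (hf : IsCost Γ f)
    (p w : List (Letter V)) : f (p ++ normalForm Γ w) ≤ f (p ++ w) := by
  induction w generalizing p with
  | nil => rfl
  | cons x w ih =>
    have := ih (p ++ [x])
    simp only [List.append_assoc, List.singleton_append] at this
    exact (hf.push_le x p _).trans this

/-- Reduced words minimize every cost. -/
theorem IsCost.le_of_reduced {f : List (Letter V) → ℕ} (hf : IsCost Γ f)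
    {w w' : List (Letter V)} (h : Reduced Γ w) (hw : wordVal Γ w = wordVal Γ w') :
    f w ≤ f w' := by
  -- The cost of `w` is that of any normal form of the same element, and normalizing `w'` does not
  -- raise its cost.
  have h1 := hf.traceEq (traceEq_normalForm hw) []
  have h2 := hf.normalForm_le [] w'
  rw [h.normalForm_eq] at h1
  exact h1.trans_le h2

theorem exists_reduced (a : RAAG Γ) : ∃ w, Reduced Γ w ∧ wordVal Γ w = a := by
  obtain ⟨w, rfl⟩ := exists_word Γ a
  exact ⟨_, reduced_normalForm w, wordVal_normalForm w⟩

/-- A reduced word representing an element of `A_Γ`. -/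
noncomputable def reducedWord (a : RAAG Γ) : List (Letter V) := (exists_reduced a).choose

theorem reduced_reducedWord (a : RAAG Γ) : Reduced Γ (reducedWord a) :=
  (exists_reduced a).choose_spec.1

@[simp] theorem wordVal_reducedWord (a : RAAG Γ) : wordVal Γ (reducedWord a) = a :=
  (exists_reduced a).choose_spec.2

/-- The word length of an element of `A_Γ`. -/
noncomputable def wordLength (a : RAAG Γ) : ℕ := (reducedWord a).length

theorem isCost_length : IsCost Γ List.length where
  swap p q x y _ := by simp
  cancel p q x := by
    simp only [List.length_append, List.length_cons]
    lia

theorem wordLength_le (w : List (Letter V)) : wordLength (wordVal Γ w) ≤ w.length :=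
  isCost_length.le_of_reduced (reduced_reducedWord _) (wordVal_reducedWord _)

theorem Reduced.wordLength_eq {w : List (Letter V)} (h : Reduced Γ w) :
    wordLength (wordVal Γ w) = w.length :=
  (wordLength_le w).antisymm (isCost_length.le_of_reduced h (wordVal_reducedWord _).symm)

theorem wordLength_mul (a b : RAAG Γ) : wordLength (a * b) ≤ wordLength a + wordLength b := by
  have := wordLength_le (Γ := Γ) (reducedWord a ++ reducedWord b)
  simpa [wordLength] using this

end Words

/-! ### Lengths of conjugacy classes as stable word lengths -/

section Stable

variable {V : Type*} {Γ : SimpleGraph V}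

theorem conjLength_le (w : List (Letter V)) :
    conjLength Γ (ConjClasses.mk (wordVal Γ w)) ≤ w.length :=
  Nat.sInf_le ⟨w, rfl, rfl⟩

theorem exists_conjLength (c : ConjClasses (RAAG Γ)) :
    ∃ w : List (Letter V), ConjClasses.mk (wordVal Γ w) = c ∧ w.length = conjLength Γ c := by
  have hne : {n | ∃ w : List (Letter V), ConjClasses.mk (wordVal Γ w) = c ∧
      w.length = n}.Nonempty := by
    obtain ⟨a, rfl⟩ := ConjClasses.exists_rep c
    obtain ⟨w, rfl⟩ := exists_word Γ a
    exact ⟨_, w, rfl, rfl⟩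
  exact Nat.sInf_mem hne

theorem mk_wordVal_append_comm (p q : List (Letter V)) :
    ConjClasses.mk (wordVal Γ (p ++ q)) = ConjClasses.mk (wordVal Γ (q ++ p)) := by
  rw [ConjClasses.mk_eq_mk_iff_isConj, isConj_iff]
  exact ⟨(wordVal Γ p)⁻¹, by simp⟩

/-- A cyclic rotation of a minimal word is minimal too, so it admits no cancellation; a cancelled
pair would leave a shorter conjugate. -/
theorem not_extract_of_minimal {w p q u : List (Letter V)} {x : Letter V}
    (hw : conjLength Γ (ConjClasses.mk (wordVal Γ w)) = w.length) (hpq : w = p ++ x :: q) :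
    ¬ Extract Γ x.inv (q ++ p) u := by
  intro h
  have h1 : ConjClasses.mk (wordVal Γ w) = ConjClasses.mk (wordVal Γ u) := by
    rw [hpq, mk_wordVal_append_comm, List.cons_append, wordVal_cons, h.wordVal, letterVal_inv,
      mul_inv_cancel_left]
  have h2 := conjLength_le (Γ := Γ) u
  rw [← h1, hw] at h2
  have h3 := h.length
  simp only [hpq, List.length_append, List.length_cons] at h2 h3
  lia

/-- Powers of words of minimal length in their conjugacy class are reduced. -/
theorem reduced_append_pow {w : List (Letter V)}
    (hw : conjLength Γ (ConjClasses.mk (wordVal Γ w)) = w.length) (b : ℕ)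
    (p q : List (Letter V)) (hpq : w = p ++ q) :
    Reduced Γ (q ++ (List.replicate b w).flatten) := by
  have step : ∀ b, Reduced Γ (List.replicate b w).flatten → ∀ q p, w = p ++ q →
      Reduced Γ (q ++ (List.replicate b w).flatten) := by
    intro b hb q
    induction q with
    | nil => intro p _; exact hb
    | cons x q ih =>
      intro p hpq
      refine ⟨ih (p ++ [x]) (by simpa using hpq), fun u hu => ?_⟩
      rcases hu.of_append with ⟨u', hu'⟩ | ⟨hq, u', hu'⟩
      · exact not_extract_of_minimal hw hpq (hu'.append_right p)
      · cases b with
        | zero => cases hu'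
        | succ b =>
          rw [List.replicate_succ, List.flatten_cons, hpq, List.append_assoc] at hu'
          rcases hu'.of_append with ⟨s, hs⟩ | ⟨_, s, hs⟩
          · exact not_extract_of_minimal hw hpq (hs.append_left hq)
          -- If the cancelling letter lies beyond the next copy of `x`, it would have to commute
          -- past that copy, but no vertex is adjacent to itself.
          · have hx : x.inv ≠ x := x.inv_ne
            have hx' : x.inv.1 = x.1 := rfl
            generalize x.inv = y at hs hx hx'
            rw [List.cons_append] at hs
            cases hs with
            | head => exact hx rfl
            | cons ha _ => exact Γ.loopless.irrefl _ (hx' ▸ ha)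
  induction b generalizing p q with
  | zero => exact step 0 trivial q p hpq
  | succ b ih =>
    refine step (b + 1) ?_ q p hpq
    rw [List.replicate_succ, List.flatten_cons]
    exact ih [] w rfl

theorem wordVal_flatten_replicate (w : List (Letter V)) (k : ℕ) :
    wordVal Γ (List.replicate k w).flatten = wordVal Γ w ^ k := by
  induction k with
  | zero => simp
  | succ k ih => rw [List.replicate_succ, List.flatten_cons, wordVal_append, ih, pow_succ']

theorem wordLength_pow_of_minimal {w : List (Letter V)}
    (hw : conjLength Γ (ConjClasses.mk (wordVal Γ w)) = w.length) (k : ℕ) :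
    wordLength (wordVal Γ w ^ k) = k * w.length := by
  have h := reduced_append_pow hw k w [] (by simp)
  rw [List.nil_append] at h
  rw [← wordVal_flatten_replicate, h.wordLength_eq]
  simp

/-- The length of the conjugacy class of `a` is the stable word length of `a`. -/
theorem exists_bound_wordLength_pow (a : RAAG Γ) : ∃ C, ∀ k : ℕ,
    wordLength (a ^ k) ≤ k * conjLength Γ (ConjClasses.mk a) + C ∧
    k * conjLength Γ (ConjClasses.mk a) ≤ wordLength (a ^ k) + C := by
  obtain ⟨w, hw, hl⟩ := exists_conjLength (ConjClasses.mk a)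
  rw [← hl]
  rw [← hw] at hl
  obtain ⟨h, hh⟩ := isConj_iff.1 (ConjClasses.mk_eq_mk_iff_isConj.1 hw)
  -- The `k`-th powers of `a` and of its minimal conjugate are conjugate by the same `h` for all
  -- `k`, so the error does not grow.
  refine ⟨wordLength h + wordLength h⁻¹, fun k => ?_⟩
  have h1 : a ^ k = h * wordVal Γ w ^ k * h⁻¹ := by rw [← hh, conj_pow]
  have h2 : wordVal Γ w ^ k = h⁻¹ * a ^ k * h := by rw [h1]; group
  have h3 := wordLength_pow_of_minimal hl.symm k
  have h4 := wordLength_mul (h * wordVal Γ w ^ k) h⁻¹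
  have h5 := wordLength_mul h (wordVal Γ w ^ k)
  have h6 := wordLength_mul (h⁻¹ * a ^ k) h
  have h7 := wordLength_mul h⁻¹ (a ^ k)
  rw [← h1] at h4
  rw [← h2] at h6
  lia

/-- An inequality between word lengths of images under automorphisms is inherited by the
lengths of conjugacy classes. -/
theorem conjLength_add_le {α β γ δ : MulAut (RAAG Γ)}
    (h : ∀ a, wordLength (α a) + wordLength (β a) ≤ wordLength (γ a) + wordLength (δ a))
    (c : ConjClasses (RAAG Γ)) :
    conjLength Γ (autConj α c) + conjLength Γ (autConj β c) ≤
      conjLength Γ (autConj γ c) + conjLength Γ (autConj δ c) := by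
  obtain ⟨a, rfl⟩ := ConjClasses.exists_rep c
  simp only [autConj_mk]
  obtain ⟨C₁, h₁⟩ := exists_bound_wordLength_pow (α a)
  obtain ⟨C₂, h₂⟩ := exists_bound_wordLength_pow (β a)
  obtain ⟨C₃, h₃⟩ := exists_bound_wordLength_pow (γ a)
  obtain ⟨C₄, h₄⟩ := exists_bound_wordLength_pow (δ a)
  generalize conjLength Γ (ConjClasses.mk (α a)) = n₁ at *
  generalize conjLength Γ (ConjClasses.mk (β a)) = n₂ at *
  generalize conjLength Γ (ConjClasses.mk (γ a)) = n₃ at *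
  generalize conjLength Γ (ConjClasses.mk (δ a)) = n₄ at *
  by_contra! hlt
  -- A violation by at least 1 grows to at least `k` on `k`-th powers, which exceeds the total
  -- bounded error.
  set k := C₁ + C₂ + C₃ + C₄ + 1 with hk
  have h5 := h (a ^ k)
  simp only [map_pow] at h5
  have h6 := Nat.mul_le_mul_left k (Nat.succ_le_of_lt hlt)
  have h7 := (h₁ k).2
  have h8 := (h₂ k).2
  have h9 := (h₃ k).1
  have h10 := (h₄ k).1
  rw [Nat.mul_succ, Nat.mul_add, Nat.mul_add] at h6
  lia

variable [Finite V]

/-- The inequality holds for each conjugacy class separately. Inverses enter because lengths at a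
marking are measured after applying its inverse. -/
theorem normZero_add_le (φ : OutL Γ) {A B C D : OutL Γ} {α β γ δ : MulAut (RAAG Γ)}
    (hA : (A : Out (RAAG Γ)) = toOut α) (hB : (B : Out (RAAG Γ)) = toOut β)
    (hC : (C : Out (RAAG Γ)) = toOut γ) (hD : (D : Out (RAAG Γ)) = toOut δ)
    (h : ∀ a, wordLength (α⁻¹ a) + wordLength (β⁻¹ a) ≤
      wordLength (γ⁻¹ a) + wordLength (δ⁻¹ a)) :
    normZero Γ (MarkedSalvetti.mk Γ (φ * A)) + normZero Γ (MarkedSalvetti.mk Γ (φ * B)) ≤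
      normZero Γ (MarkedSalvetti.mk Γ (φ * C)) + normZero Γ (MarkedSalvetti.mk Γ (φ * D)) := by
  have key : ∀ {E : OutL Γ} {ε : MulAut (RAAG Γ)}, (E : Out (RAAG Γ)) = toOut ε →
      normZero Γ (MarkedSalvetti.mk Γ (φ * E)) = ∑ g ∈ (shortClasses_finite Γ).toFinset,
        conjLength Γ (autConj ε⁻¹ (outConj (φ : Out (RAAG Γ))⁻¹ g)) := by
    intro E ε hE
    refine Finset.sum_congr rfl fun g _ => ?_
    rw [markedLength, Subgroup.coe_mul, mul_inv_rev, map_mul, Equiv.Perm.mul_apply, hE,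
      ← map_inv]
    rfl
  rw [key hA, key hB, key hC, key hD, ← Finset.sum_add_distrib, ← Finset.sum_add_distrib]
  exact Finset.sum_le_sum fun g _ => conjLength_add_le h _

end Stable

/-! ### Whitehead automorphisms and word length -/

section Crossing

variable {V : Type*} {Γ : SimpleGraph V} {P Q : Set (Letter V)} {m v w : Letter V}

/-! ### Whitehead conditions along edges of the graph. -/

theorem notMem_star_iff {a b : V} : a ∉ star Γ b ↔ a ≠ b ∧ ¬ Γ.Adj a b := by
  simp [star, Γ.adj_comm]

/-- For an edge of `Γ ∖ st(m)`, condition (2) forbids separating a letter from its inverse, since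
the other endpoint is not in `st(m)`; condition (3) then puts both endpoints on the same side. Signs
are irrelevant, so this applies to all four letters of the edge. -/
theorem WhiteheadConditions.mem_iff_of_adj (h : WhiteheadConditions Γ P m) {x y : Letter V}
    (hxy : Γ.Adj x.1 y.1) (hx : x.1 ∉ star Γ m.1) (hy : y.1 ∉ star Γ m.1) :
    x ∈ P ↔ y ∈ P := by
  have both : ∀ {x : Letter V} {z : V}, Γ.Adj x.1 z → z ∉ star Γ m.1 → x ∈ P →
      (x.1, true) ∈ P ∧ (x.1, false) ∈ P := by
    rintro ⟨u, b⟩ z hz hzs hP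
    obtain ⟨h1, h2⟩ := notMem_star_iff.1 hzs
    have h3 := h.single_adj hz h1 h2 hP
    cases b
    · exact ⟨h3, hP⟩
    · exact ⟨hP, h3⟩
  have one : ∀ {x y : Letter V}, Γ.Adj x.1 y.1 → x.1 ∉ star Γ m.1 → y.1 ∉ star Γ m.1 →
      x ∈ P → y ∈ P := by
    rintro x ⟨u, b⟩ hxy hx hy hP
    obtain ⟨h1, h2⟩ := both hxy hy hP
    obtain ⟨h3, h4⟩ := h.comp _ h1 h2 u ⟨hx, hy, SimpleGraph.Adj.reachable hxy⟩
    cases b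
    · exact h4
    · exact h3
  exact ⟨one hxy hx hy, one hxy.symm hy hx⟩

/-- The conditions on a Whitehead pair can be checked on edges of `Γ ∖ st(m)`. -/
theorem WhiteheadConditions.of_adj (mem : m ∈ P) (inv_notMem : m.inv ∉ P)
    (not_adj : ∀ x ∈ P, ¬ Γ.Adj x.1 m.1)
    (hadj : ∀ x y : Letter V, Γ.Adj x.1 y.1 → x.1 ∉ star Γ m.1 → y.1 ∉ star Γ m.1 →
      x ∈ P → y ∈ P) : WhiteheadConditions Γ P m where
  mem := mem
  inv_notMem := inv_notMem
  not_adj := not_adj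
  le := by
    intro x hx hx' b hb
    by_contra hbs
    by_cases hxm : x.1 = m.1
    · exact hbs (Or.inr (hxm ▸ hb))
    have hxs : x.1 ∉ star Γ m.1 := notMem_star_iff.2 ⟨hxm, not_adj x hx⟩
    -- Crossing the same edge back and forth carries `x` to its inverse.
    exact hx' (hadj (b, true) x.inv (Γ.adj_symm hb) hbs hxs
      (hadj x (b, true) hb hxs hbs hx))
  comp := by
    rintro a ha ha' b ⟨has, hbs, ⟨p⟩⟩
    have key : ∀ {a b : ((star Γ m.1)ᶜ : Set V)}, (Γ.induce (star Γ m.1)ᶜ).Walk a b →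
        (a.1, true) ∈ P ∧ (a.1, false) ∈ P → (b.1, true) ∈ P ∧ (b.1, false) ∈ P := by
      intro a b p
      induction p with
      | nil => exact id
      | @cons a c b hac _ ih =>
        intro h
        exact ih ⟨hadj (a.1, true) (c.1, true) hac a.2 c.2 h.1,
          hadj (a.1, true) (c.1, false) hac a.2 c.2 h.1⟩
    exact key p ⟨ha, ha'⟩

/-! ### Letter counts, crossing numbers and the length formula. -/

open Classical in
/-- The number of letters of a word whose vertex satisfies `p`. -/
noncomputable def vertexCount (p : V → Prop) (w : List (Letter V)) : ℕ :=
  w.countP fun x => p x.1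

@[simp] theorem vertexCount_nil (p : V → Prop) : vertexCount p [] = 0 := rfl

@[simp] theorem vertexCount_append (p : V → Prop) (w u : List (Letter V)) :
    vertexCount p (w ++ u) = vertexCount p w + vertexCount p u := by
  simp [vertexCount]

open Classical in
theorem vertexCount_cons (p : V → Prop) (x : Letter V) (w : List (Letter V)) :
    vertexCount p (x :: w) = vertexCount p w + if p x.1 then 1 else 0 := by
  simp [vertexCount, List.countP_cons]

theorem vertexCount_add_not (p : V → Prop) (w : List (Letter V)) :
    vertexCount p w + vertexCount (fun u => ¬ p u) w = w.length := by
  classical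
  induction w with
  | nil => rfl
  | cons x w ih =>
    by_cases h : p x.1 <;> simp [vertexCount_cons, h] <;> lia

theorem isCost_vertexCount (p : V → Prop) : IsCost Γ (vertexCount p) where
  swap a b x y _ := by
    simp only [vertexCount_append, vertexCount_cons]
    lia
  cancel a b x := by
    simp only [vertexCount_append, vertexCount_cons]
    lia

open Classical in
/-- The indicator function of a set of letters. -/
noncomputable def side (P : Set (Letter V)) (x : Letter V) : Bool := decide (x ∈ P)

@[simp] theorem side_eq_true {x : Letter V} : side P x = true ↔ x ∈ P := by simp [side]

@[simp] theorem side_eq_false {x : Letter V} : side P x = false ↔ x ∉ P := by simp [side]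

open Classical in
/-- The number of times a path in the blow-up of the Salvetti complex along `(P, m)` that spells
a word crosses the edge dual to `P`, if the path starts on the side `s` and ends outside `P`. -/
noncomputable def crossing (Γ : SimpleGraph V) (P : Set (Letter V)) (m : Letter V) :
    Bool → List (Letter V) → ℕ
  | s, [] => s.toNat
  -- A letter adjacent to `m` runs parallel to the wall. Any other letter `x` is an edge that starts
  -- on the side of `x.inv` and ends on the side of `x`; only the passage to its starting side is
  -- charged.
  | s, x :: w => if Γ.Adj x.1 m.1 then crossing Γ P m s w
      else (s ^^ side P x.inv).toNat + crossing Γ P m (side P x) w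

theorem crossing_cons_of_adj {x : Letter V} (h : Γ.Adj x.1 m.1) (s : Bool)
    (u : List (Letter V)) : crossing Γ P m s (x :: u) = crossing Γ P m s u := by
  simp [crossing, h]

theorem crossing_cons_of_not_adj {x : Letter V} (h : ¬ Γ.Adj x.1 m.1) (s : Bool)
    (u : List (Letter V)) : crossing Γ P m s (x :: u) =
      (s ^^ side P x.inv).toNat + crossing Γ P m (side P x) u := by
  simp [crossing, h]

theorem crossing_congr (h : ∀ u, Γ.Adj u v.1 ↔ Γ.Adj u w.1) (s : Bool) (u : List (Letter V)) :
    crossing Γ P v s u = crossing Γ P w s u := by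
  induction u generalizing s with
  | nil => rfl
  | cons x u ih => by_cases hx : Γ.Adj x.1 w.1 <;> simp [crossing, h, hx, ih]

theorem toNat_xor_le (a b c : Bool) : (a ^^ c).toNat ≤ (a ^^ b).toNat + (b ^^ c).toNat := by
  revert a b c
  decide

theorem crossing_le (s t : Bool) (u : List (Letter V)) :
    crossing Γ P m s u ≤ (s ^^ t).toNat + crossing Γ P m t u := by
  induction u generalizing s t with
  | nil => simpa [crossing] using toNat_xor_le s t false
  | cons x u ih =>
    by_cases hx : Γ.Adj x.1 m.1
    · simpa only [crossing_cons_of_adj hx] using ih s t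
    · have := toNat_xor_le s t (side P x.inv)
      simp only [crossing_cons_of_not_adj hx]
      lia

theorem crossing_append_mono {q q' : List (Letter V)}
    (h : ∀ s, crossing Γ P m s q ≤ crossing Γ P m s q') (p : List (Letter V)) (s : Bool) :
    crossing Γ P m s (p ++ q) ≤ crossing Γ P m s (p ++ q') := by
  induction p generalizing s with
  | nil => exact h s
  | cons x p ih =>
    by_cases hx : Γ.Adj x.1 m.1
    · simpa only [List.cons_append, crossing_cons_of_adj hx] using ih s
    · simpa only [List.cons_append, crossing_cons_of_not_adj hx] using
        Nat.add_le_add_left (ih _) _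

/-- Exchanging commuting letters is harmless: either one of them is invisible to the wall, or both
vertices lie outside `st(m)` and all their letters are on one side. A cancelling pair is a detour
that returns to its starting side, so removing it is the triangle inequality for sides. -/
theorem WhiteheadConditions.isCost_crossing (h : WhiteheadConditions Γ P m) (s : Bool) :
    IsCost Γ (crossing Γ P m s) where
  swap p q x y hxy := by
    have key : ∀ {x y : Letter V}, Γ.Adj x.1 y.1 → ∀ s,
        crossing Γ P m s (x :: y :: q) ≤ crossing Γ P m s (y :: x :: q) := by
      intro x y hxy s
      by_cases hx : Γ.Adj x.1 m.1 <;> by_cases hy : Γ.Adj y.1 m.1 <;>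
        simp only [crossing, hx, hy, if_true, if_false, le_refl]
      have hxs : x.1 ∉ star Γ m.1 :=
        notMem_star_iff.2 ⟨fun e => hy (e ▸ hxy.symm), hx⟩
      have hys : y.1 ∉ star Γ m.1 :=
        notMem_star_iff.2 ⟨fun e => hx (e ▸ hxy), hy⟩
      have e1 : side P x = side P y := by
        simpa [side] using h.mem_iff_of_adj hxy hxs hys
      have e2 : side P x.inv = side P y := by
        simpa [side] using h.mem_iff_of_adj (x := x.inv) hxy hxs hys
      have e3 : side P y.inv = side P x := by
        simpa [side] using (h.mem_iff_of_adj (y := y.inv) hxy hxs hys).symm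
      rw [e2, e3, e1]
    exact (crossing_append_mono (key hxy) p s).antisymm (crossing_append_mono (key hxy.symm) p s)
  cancel p q x := by
    refine crossing_append_mono (fun s => ?_) p s
    by_cases hx : Γ.Adj x.1 m.1
    · rw [crossing_cons_of_adj hx, crossing_cons_of_adj (x := x.inv) hx]
    · rw [crossing_cons_of_not_adj hx, crossing_cons_of_not_adj (x := x.inv) hx]
      simpa using crossing_le s _ q

/-- The value of a letter, or the identity. -/
def boolVal (Γ : SimpleGraph V) (m : Letter V) (s : Bool) : RAAG Γ :=
  if s then letterVal Γ m else 1

@[simp] theorem boolVal_true : boolVal Γ m true = letterVal Γ m := rfl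

@[simp] theorem boolVal_false : boolVal Γ m false = 1 := rfl

theorem letterVal_boolVal_comm {x : Letter V} (h : Γ.Adj x.1 m.1) (s : Bool) :
    letterVal Γ x * boolVal Γ m s = boolVal Γ m s * letterVal Γ x := by
  cases s
  · simp
  · exact letterVal_comm h

/-- One formula for all four cases of the definition: the exponents of `m` on the two sides are
indicators of `P`. -/
theorem WhiteheadConditions.aut_letterVal (h : WhiteheadConditions Γ P m) {x : Letter V}
    (hx : x.1 ≠ m.1) : whiteheadAut h (letterVal Γ x) =
      boolVal Γ m (side P x.inv) * letterVal Γ x * (boolVal Γ m (side P x))⁻¹ := by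
  obtain ⟨u, b⟩ := x
  have ht : letterVal Γ (u, true) = gen Γ u := by simp [letterVal]
  have hf : letterVal Γ (u, false) = (gen Γ u)⁻¹ := by simp [letterVal]
  by_cases h1 : (u, true) ∈ P <;> by_cases h2 : (u, false) ∈ P <;> cases b <;>
    simp [ht, hf, whiteheadAut_gen, whiteheadFun, hx, h1, h2, side, Letter.inv, boolVal,
      mul_assoc]

theorem WhiteheadConditions.side_of_adj (h : WhiteheadConditions Γ P m) {x : Letter V}
    (hx : Γ.Adj x.1 m.1) : side P x = false :=
  side_eq_false.2 fun hP => h.not_adj x hP hx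

theorem WhiteheadConditions.aut_letterVal_of_adj (h : WhiteheadConditions Γ P m) {x : Letter V}
    (hx : Γ.Adj x.1 m.1) : whiteheadAut h (letterVal Γ x) = letterVal Γ x := by
  rw [h.aut_letterVal hx.ne, h.side_of_adj hx, h.side_of_adj (x := x.inv) hx]
  simp

/-- The blocks replacing the letters of a word under the Whitehead automorphism `(P, m)`. -/
theorem WhiteheadConditions.exists_image (h : WhiteheadConditions Γ P m) (u : List (Letter V))
    (s : Bool) : ∃ u', wordVal Γ u' = (boolVal Γ m s)⁻¹ * whiteheadAut h (wordVal Γ u) ∧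
      (∀ p : V → Prop, ¬ p m.1 → vertexCount p u' = vertexCount p u) ∧
      vertexCount (· = m.1) u' ≤ crossing Γ P m s u := by
  -- Between consecutive letters of the image the powers of `m` combine to a single `m` or `m⁻¹`, or
  -- to nothing, according to whether the wall is crossed.
  have trans : ∀ s t : Bool, ∃ u', wordVal Γ u' = (boolVal Γ m s)⁻¹ * boolVal Γ m t ∧
      (∀ p : V → Prop, ¬ p m.1 → vertexCount p u' = 0) ∧
      vertexCount (· = m.1) u' ≤ (s ^^ t).toNat := by
    intro s t
    cases s <;> cases t
    · exact ⟨[], by simp⟩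
    · exact ⟨[m], by simp +contextual [vertexCount_cons]⟩
    · exact ⟨[m.inv], by simp +contextual [vertexCount_cons, letterVal_inv]⟩
    · exact ⟨[], by simp⟩
  induction u generalizing s with
  | nil =>
    obtain ⟨u', h1, h2, h3⟩ := trans s false
    exact ⟨u', by simpa using h1, h2, by simpa [crossing] using h3⟩
  | cons x u ih =>
    by_cases hx : Γ.Adj x.1 m.1
    · obtain ⟨u', h1, h2, h3⟩ := ih s
      refine ⟨x :: u', ?_, fun p hp => ?_, ?_⟩
      · have := letterVal_boolVal_comm hx s
        rw [wordVal_cons, h1, wordVal_cons, map_mul, h.aut_letterVal_of_adj hx, ← mul_assoc,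
          ← mul_assoc, mul_inv_eq_iff_eq_mul.2 (by rw [mul_assoc, this, inv_mul_cancel_left])]
      · simp [vertexCount_cons, h2 p hp]
      · simpa [crossing_cons_of_adj hx, vertexCount_cons, hx.ne] using h3
    obtain ⟨u₁, h1, h2, h3⟩ := trans s (side P x.inv)
    obtain ⟨u₂, h4, h5, h6⟩ := ih (side P x)
    rw [crossing_cons_of_not_adj hx]
    by_cases hm : x.1 = m.1
    -- A base letter leaves no middle letter: its inverted image is already spelled by the side
    -- changes around it.
    · refine ⟨u₁ ++ u₂, ?_, fun p hp => ?_, ?_⟩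
      · rw [wordVal_append, h1, h4, wordVal_cons, map_mul]
        have hmem := side_eq_true.2 h.mem
        have hinv := side_eq_false.2 h.inv_notMem
        rcases Letter.eq_or_eq_inv hm with rfl | rfl
        · simp [hmem, hinv, whiteheadAut_m]
        · simp [hmem, hinv, whiteheadAut_m, letterVal_inv, mul_assoc]
      · rw [vertexCount_append, h2 p hp, h5 p hp, vertexCount_cons, hm]
        simp [hp]
      · rw [vertexCount_append]
        exact Nat.add_le_add h3 h6
    · refine ⟨u₁ ++ x :: u₂, ?_, fun p hp => ?_, ?_⟩
      · rw [wordVal_append, wordVal_cons, h1, h4, wordVal_cons, map_mul, h.aut_letterVal hm]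
        group
      · rw [vertexCount_append, vertexCount_cons, h2 p hp, h5 p hp, vertexCount_cons, zero_add]
      · rw [vertexCount_append, vertexCount_cons, if_neg hm, add_zero]
        exact Nat.add_le_add h3 h6

/-- Here the letters `m` and `m⁻¹` inserted by the automorphism are kept: traversing them switches
sides without crossing the wall. Thus ordinary letters cost nothing, and only the base letters of
`u` can cost a crossing, at most one each. -/
theorem WhiteheadConditions.exists_image_crossing (h : WhiteheadConditions Γ P m)
    (u : List (Letter V)) : ∃ u', wordVal Γ u' = whiteheadAut h (wordVal Γ u) ∧
      (∀ p : V → Prop, ¬ p m.1 → vertexCount p u' = vertexCount p u) ∧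
      crossing Γ P m false u' ≤ vertexCount (· = m.1) u := by
  have hmem := side_eq_true.2 h.mem
  have hinv := side_eq_false.2 h.inv_notMem
  have hmm : ¬ Γ.Adj m.1 m.1 := Γ.loopless.irrefl _
  have hmm' : ¬ Γ.Adj m.inv.1 m.1 := hmm
  induction u with
  | nil => exact ⟨[], by simp [crossing]⟩
  | cons x u ih =>
    obtain ⟨u', h1, h2, h3⟩ := ih
    by_cases hx : Γ.Adj x.1 m.1
    · refine ⟨x :: u', ?_, fun p hp => ?_, ?_⟩
      · rw [wordVal_cons, h1, wordVal_cons, map_mul, h.aut_letterVal_of_adj hx]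
      · simp [vertexCount_cons, h2 p hp]
      · simpa [crossing_cons_of_adj hx, vertexCount_cons, hx.ne] using h3
    by_cases hm : x.1 = m.1
    · refine ⟨x.inv :: u', ?_, fun p hp => ?_, ?_⟩
      · rw [wordVal_cons, h1, wordVal_cons, map_mul]
        congr 1
        rcases Letter.eq_or_eq_inv hm with rfl | rfl
        · rw [whiteheadAut_m, letterVal_inv]
        · rw [letterVal_inv m, map_inv, whiteheadAut_m, Letter.inv_inv, inv_inv]
      · rw [vertexCount_cons, vertexCount_cons, h2 p hp, Letter.inv_fst]
      -- When the inverted letter is `m`, the path ends up inside `P`; returning outside costs at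
      -- most one crossing.
      · have h4 := crossing_le (Γ := Γ) (P := P) (m := m) true false u'
        rw [vertexCount_cons, if_pos hm, crossing_cons_of_not_adj (x := x.inv) hx]
        rcases Letter.eq_or_eq_inv hm with rfl | rfl
        · simp only [hmem, hinv, Letter.inv_inv, Bool.false_xor, Bool.toNat_true]
          lia
        · simp only [hmem, hinv, Letter.inv_inv, Bool.false_xor, Bool.toNat_false]
          simp only [Bool.true_xor, Bool.not_false, Bool.toNat_true] at h4
          lia
    · obtain ⟨l, hl, hl', hl''⟩ : ∃ l, wordVal Γ l = boolVal Γ m (side P x.inv) ∧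
          (∀ p : V → Prop, ¬ p m.1 → vertexCount p l = 0) ∧
          ∀ t, crossing Γ P m false (l ++ t) = crossing Γ P m (side P x.inv) t := by
        cases side P x.inv
        · exact ⟨[], by simp⟩
        · exact ⟨[m], by simp, by simp +contextual [vertexCount_cons],
            by simp [crossing_cons_of_not_adj hmm, hmem, hinv]⟩
      obtain ⟨r, hr, hr', hr''⟩ : ∃ r, wordVal Γ r = (boolVal Γ m (side P x))⁻¹ ∧
          (∀ p : V → Prop, ¬ p m.1 → vertexCount p r = 0) ∧
          ∀ t, crossing Γ P m (side P x) (r ++ t) = crossing Γ P m false t := by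
        cases side P x
        · exact ⟨[], by simp⟩
        · exact ⟨[m.inv], by simp [letterVal_inv], by simp +contextual [vertexCount_cons],
            by simp [crossing_cons_of_not_adj hmm', hmem, hinv]⟩
      refine ⟨l ++ x :: (r ++ u'), ?_, fun p hp => ?_, ?_⟩
      · rw [wordVal_append, wordVal_cons, wordVal_append, hl, hr, h1, wordVal_cons, map_mul,
          h.aut_letterVal hm]
        group
      · rw [vertexCount_append, vertexCount_cons, vertexCount_append, hl' p hp, hr' p hp, h2 p hp,
          vertexCount_cons]
        simp
      · rw [hl'', crossing_cons_of_not_adj hx, hr'', vertexCount_cons, if_neg hm]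
        simpa using h3

theorem whiteheadAut_whiteheadAut (h : WhiteheadConditions Γ P m) (a : RAAG Γ) :
    whiteheadAut h (whiteheadAut h a) = a :=
  DFunLike.congr_fun (whiteheadAut_sq h) a

/-- The change of word length under a Whitehead automorphism. -/
theorem WhiteheadConditions.wordLength_aut (h : WhiteheadConditions Γ P m)
    {u : List (Letter V)} (hu : Reduced Γ u) :
    wordLength (whiteheadAut h (wordVal Γ u)) + vertexCount (· = m.1) u =
      u.length + crossing Γ P m false u := by
  have e1 := vertexCount_add_not (· = m.1) u
  apply le_antisymm
  · obtain ⟨u', h1, h2, h3⟩ := h.exists_image u false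
    have h4 := wordLength_le (Γ := Γ) u'
    have e2 := vertexCount_add_not (· = m.1) u'
    have h5 := h2 (fun v => ¬ v = m.1) (by simp)
    rw [h1] at h4
    simp only [boolVal_false, inv_one, one_mul] at h4
    lia
  -- For the lower bound, transform a reduced word `r` of the image back. The resulting word
  -- represents the same element as `u`, and the reduced word `u` has the fewest non-base letters
  -- and crossings.
  · set r := reducedWord (whiteheadAut h (wordVal Γ u)) with hr
    have e2 := vertexCount_add_not (· = m.1) r
    obtain ⟨u', h1, h2, h3⟩ := h.exists_image_crossing r
    rw [hr, wordVal_reducedWord, whiteheadAut_whiteheadAut] at h1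
    have h4 := (isCost_vertexCount fun v => ¬ v = m.1).le_of_reduced hu h1.symm
    have h5 := (h.isCost_crossing false).le_of_reduced hu h1.symm
    have h6 := h2 (fun v => ¬ v = m.1) (by simp)
    change _ ≤ r.length + _
    lia

/-- The number of occurrences of vertices satisfying `p` in a reduced word. -/
noncomputable def vertexLength (p : V → Prop) (a : RAAG Γ) : ℕ :=
  vertexCount p (reducedWord a)

theorem vertexLength_split {p q : V → Prop} (hpq : ∀ u, q u → ¬ p u) (a : RAAG Γ) :
    vertexLength p a + vertexLength q a + vertexLength (fun u => ¬ p u ∧ ¬ q u) a =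
      wordLength a := by
  unfold vertexLength wordLength
  induction reducedWord a with
  | nil => rfl
  | cons x w ih =>
    have := hpq x.1
    simp only [vertexCount_cons, List.length_cons]
    split_ifs <;> lia

/-- Only base letters are inserted or removed, so other counts cannot increase; since the
automorphism is an involution, they cannot decrease either. -/
theorem WhiteheadConditions.vertexLength_aut (h : WhiteheadConditions Γ P m) {p : V → Prop}
    (hp : ¬ p m.1) (a : RAAG Γ) : vertexLength p (whiteheadAut h a) = vertexLength p a := by
  have key : ∀ a, vertexLength p (whiteheadAut h a) ≤ vertexLength p a := by
    intro a
    obtain ⟨u', h1, h2, _⟩ := h.exists_image (reducedWord a) false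
    unfold vertexLength
    rw [← h2 p hp]
    refine (isCost_vertexCount p).le_of_reduced (reduced_reducedWord _) ?_
    rw [h1, wordVal_reducedWord, wordVal_reducedWord]
    simp
  refine (key a).antisymm ?_
  have := key (whiteheadAut h a)
  rwa [whiteheadAut_whiteheadAut] at this

/-- Word lengths are additive along squares of Whitehead automorphisms. -/
theorem wordLength_square {P' Q' : Set (Letter V)} (hP : WhiteheadConditions Γ P v)
    (hQ : WhiteheadConditions Γ Q w) (hP' : WhiteheadConditions Γ P' v)
    (hQ' : WhiteheadConditions Γ Q' w) (hvw : v.1 ≠ w.1)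
    (hsq : whiteheadAut hQ' * whiteheadAut hP = whiteheadAut hP' * whiteheadAut hQ)
    (a : RAAG Γ) :
    wordLength (whiteheadAut hQ' (whiteheadAut hP a)) + wordLength a =
      wordLength (whiteheadAut hP a) + wordLength (whiteheadAut hQ a) := by
  have e := DFunLike.congr_fun hsq a
  rw [MulAut.mul_apply, MulAut.mul_apply] at e
  have hd : ∀ u, u = w.1 → ¬ u = v.1 := by rintro u rfl; exact hvw.symm
  simp only [← vertexLength_split hd]
  -- Count letters on `v`, on `w` and elsewhere. A move based at `w` preserves the count on `v`, and
  -- conversely. The two routes around the square determine both counts at the fourth corner.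
  have h1 := hQ'.vertexLength_aut (p := (· = v.1)) hvw.symm (whiteheadAut hP a)
  have h2 := hP'.vertexLength_aut (p := (· = w.1)) hvw (whiteheadAut hQ a)
  have h3 := hQ.vertexLength_aut (p := (· = v.1)) hvw.symm a
  have h4 := hP.vertexLength_aut (p := (· = w.1)) hvw a
  have h5 := hQ'.vertexLength_aut (p := fun u => ¬ u = v.1 ∧ ¬ u = w.1) (by simp)
    (whiteheadAut hP a)
  have h6 := hQ.vertexLength_aut (p := fun u => ¬ u = v.1 ∧ ¬ u = w.1) (by simp) a
  rw [← e] at h2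
  lia

/-! ### Submodularity. -/

/-- The two summands in `p'`, `q'` vanish. They match the error terms of the induction hypothesis in
`crossing_diff_add_le` when the difference walls start on their true sides. -/
theorem crossing_diff_bound (s t a b p q p' q' : Bool) :
    (a ^^ (p && !q)).toNat + (b ^^ (q && !p)).toNat
      + ((p' && !q') ^^ (p' && !q')).toNat + ((q' && !p') ^^ (q' && !p')).toNat ≤
    (s ^^ p).toNat + (t ^^ q).toNat + (a ^^ (s && !t)).toNat + (b ^^ (t && !s)).toNat := by
  revert s t a b p q p' q'
  decide

theorem side_diff (x : Letter V) : side (P \ Q) x = (side P x && !side Q x) := by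
  classical
  by_cases h1 : x ∈ P <;> by_cases h2 : x ∈ Q <;> simp [side, h1, h2]

/-- The letters `x` and `v` then span an edge of `Γ ∖ st(w)` and so lie on the same side of `Q`. -/
theorem WhiteheadConditions.notMem_of_adj (hQ : WhiteheadConditions Γ Q w) (hvQ : v ∉ Q)
    (hvw : ¬ Γ.Adj v.1 w.1) {x : Letter V} (hx : Γ.Adj x.1 v.1) (hxw : ¬ Γ.Adj x.1 w.1) :
    x ∉ Q := by
  have h1 : x.1 ∉ star Γ w.1 :=
    notMem_star_iff.2 ⟨fun e => hvw (Γ.adj_symm (e ▸ hx)), hxw⟩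
  have h2 : v.1 ∉ star Γ w.1 := notMem_star_iff.2 ⟨fun e => hxw (e ▸ hx), hvw⟩
  rwa [hQ.mem_iff_of_adj hx h1 h2]

/-- Submodularity of the crossing numbers. -/
theorem crossing_diff_add_le (hP : WhiteheadConditions Γ P v) (hQ : WhiteheadConditions Γ Q w)
    (hvQ : v ∉ Q) (hwP : w ∉ P) (hvw : ¬ Γ.Adj v.1 w.1) (u : List (Letter V)) (s t a b : Bool) :
    crossing Γ (P \ Q) v a u + crossing Γ (Q \ P) w b u ≤
      crossing Γ P v s u + crossing Γ Q w t u +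
        (a ^^ (s && !t)).toNat + (b ^^ (t && !s)).toNat := by
  -- The four starting sides must be independent: a letter visible to only one wall moves only one
  -- pair of sides, which can put the difference walls out of step with `P` and `Q`. The error terms
  -- record the discrepancy.
  induction u generalizing s t a b with
  | nil =>
    simp only [crossing]
    revert s t a b
    decide
  | cons x u ih =>
    by_cases hxv : Γ.Adj x.1 v.1 <;> by_cases hxw : Γ.Adj x.1 w.1
    · simpa only [crossing_cons_of_adj hxv, crossing_cons_of_adj hxw] using ih s t a b
    · have h1 := side_eq_false.2 (hQ.notMem_of_adj hvQ hvw hxv hxw)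
      have h2 := side_eq_false.2 (hQ.notMem_of_adj hvQ hvw (x := x.inv) hxv hxw)
      have h3 := ih s false a false
      simp only [crossing_cons_of_adj hxv, crossing_cons_of_not_adj hxw, side_diff, h1, h2,
        Bool.false_and] at h3 ⊢
      have h4 : (b ^^ false).toNat + (a ^^ (s && !false)).toNat + (false ^^ false).toNat ≤
          (t ^^ false).toNat + (a ^^ (s && !t)).toNat + (b ^^ (t && !s)).toNat := by
        clear h3
        revert s t a b
        decide
      lia
    · have hwv : ¬ Γ.Adj w.1 v.1 := fun e => hvw e.symm
      have h1 := side_eq_false.2 (hP.notMem_of_adj hwP hwv hxw hxv)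
      have h2 := side_eq_false.2 (hP.notMem_of_adj hwP hwv (x := x.inv) hxw hxv)
      have h3 := ih false t false b
      simp only [crossing_cons_of_adj hxw, crossing_cons_of_not_adj hxv, side_diff, h1, h2,
        Bool.false_and] at h3 ⊢
      have h4 : (a ^^ false).toNat + (b ^^ (t && !false)).toNat + (false ^^ false).toNat ≤
          (s ^^ false).toNat + (a ^^ (s && !t)).toNat + (b ^^ (t && !s)).toNat := by
        clear h3
        revert s t a b
        decide
      lia
    · have h3 := ih (side P x) (side Q x) (side P x && !side Q x) (side Q x && !side P x)
      have h4 := crossing_diff_bound s t a b (side P x.inv) (side Q x.inv) (side P x) (side Q x)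
      simp only [crossing_cons_of_not_adj hxv, crossing_cons_of_not_adj hxw, side_diff]
      lia

/-- The Higgins–Lyndon inequality for word lengths. -/
theorem wordLength_diff_add_le (hP : WhiteheadConditions Γ P v)
    (hQ : WhiteheadConditions Γ Q w) (hA : WhiteheadConditions Γ (P \ Q) v)
    (hB : WhiteheadConditions Γ (Q \ P) w) (hvw : ¬ Γ.Adj v.1 w.1) (a : RAAG Γ) :
    wordLength (whiteheadAut hA a) + wordLength (whiteheadAut hB a) ≤
      wordLength (whiteheadAut hP a) + wordLength (whiteheadAut hQ a) := by
  have hr := reduced_reducedWord a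
  have h1 := hP.wordLength_aut hr
  have h2 := hQ.wordLength_aut hr
  have h3 := hA.wordLength_aut hr
  have h4 := hB.wordLength_aut hr
  have h5 := crossing_diff_add_le hP hQ hA.mem.2 hB.mem.2 hvw (reducedWord a) false false false
    false
  rw [wordVal_reducedWord] at h1 h2 h3 h4
  simp only [Bool.not_false, Bool.false_and, Bool.xor_self, Bool.toNat_false] at h5
  lia

/-- Exchanging the base vertices of two Whitehead pairs with equal links. -/
theorem wordLength_exchange {v' w' : Letter V} (hP : WhiteheadConditions Γ P v)
    (hQ : WhiteheadConditions Γ Q w) (hP' : WhiteheadConditions Γ P w')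
    (hQ' : WhiteheadConditions Γ Q v') (hv : v'.1 = v.1) (hw : w'.1 = w.1)
    (hl : ∀ u, Γ.Adj u v.1 ↔ Γ.Adj u w.1) (a : RAAG Γ) :
    wordLength (whiteheadAut hP' a) + wordLength (whiteheadAut hQ' a) =
      wordLength (whiteheadAut hP a) + wordLength (whiteheadAut hQ a) := by
  have hr := reduced_reducedWord a
  have h1 := hP.wordLength_aut hr
  have h2 := hQ.wordLength_aut hr
  have h3 := hP'.wordLength_aut hr
  have h4 := hQ'.wordLength_aut hr
  -- A crossing number depends on the base only through its link, so exchanging bases merely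
  -- redistributes the subtracted base counts.
  have h5 : crossing Γ P w' false (reducedWord a) = crossing Γ P v false (reducedWord a) :=
    crossing_congr (fun u => by rw [hw, hl]) _ _
  have h6 : crossing Γ Q v' false (reducedWord a) = crossing Γ Q w false (reducedWord a) :=
    crossing_congr (fun u => by rw [hv, hl]) _ _
  rw [wordVal_reducedWord] at h1 h2 h3 h4
  rw [hw] at h3
  rw [hv] at h4
  lia

end Crossing

/-! ### Relations between Whitehead moves -/

section Moves

variable {V : Type*} {Γ : SimpleGraph V} {P Q A B R : Set (Letter V)} {m u v w : Letter V}

theorem whiteheadAut_boolVal (h : WhiteheadConditions Γ P m) (s : Bool) :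
    whiteheadAut h (boolVal Γ m s) = (boolVal Γ m s)⁻¹ := by
  cases s
  · simp
  · exact whiteheadAut_m h

theorem boolVal_inv_not (s : Bool) :
    boolVal Γ m.inv (!s) = (letterVal Γ m)⁻¹ * boolVal Γ m s := by
  cases s <;> simp [letterVal_inv]

theorem letterVal_true (a : V) : letterVal Γ (a, true) = gen Γ a := by simp [letterVal]

theorem aut_ext_letter {α β : MulAut (RAAG Γ)} (hm : α (letterVal Γ m) = β (letterVal Γ m))
    (h : ∀ x : Letter V, x.1 ≠ m.1 → α (letterVal Γ x) = β (letterVal Γ x)) : α = β := by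
  refine aut_ext fun a => ?_
  rw [← letterVal_true]
  by_cases ha : a = m.1
  · rcases Letter.eq_or_eq_inv (x := (a, true)) ha with e | e
    · rw [e, hm]
    · rw [e, letterVal_inv, map_inv, map_inv, hm]
  · exact h _ ha

/-- The side of a Whitehead pair complementary to `P`. -/
def complSide (Γ : SimpleGraph V) (P : Set (Letter V)) (m : Letter V) : Set (Letter V) :=
  {x | x ∉ P ∧ ¬ Γ.Adj x.1 m.1}

theorem WhiteheadConditions.compl (h : WhiteheadConditions Γ P m) :
    WhiteheadConditions Γ (complSide Γ P m) m.inv := by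
  refine .of_adj ⟨h.inv_notMem, Γ.loopless.irrefl _⟩ (fun hm => ?_) (fun x hx => hx.2) ?_
  · rw [Letter.inv_inv] at hm
    exact hm.1 h.mem
  · intro x y hxy hx hy hP
    exact ⟨fun hyP => hP.1 ((h.mem_iff_of_adj hxy hx hy).2 hyP), (notMem_star_iff.1 hy).2⟩

/-- Complementing flips both indicator exponents of every letter not adjacent to `m`, which is
conjugation by a power of `m`; adjacent letters commute with `m`. -/
theorem WhiteheadConditions.aut_compl (h : WhiteheadConditions Γ P m) :
    whiteheadAut h.compl = MulAut.conj (letterVal Γ m)⁻¹ * whiteheadAut h := by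
  refine aut_ext_letter (m := m) ?_ fun x hx => ?_
  · have := whiteheadAut_m h.compl
    rw [letterVal_inv, map_inv, inv_inj] at this
    rw [this, MulAut.mul_apply, whiteheadAut_m]
    simp
  · rw [MulAut.mul_apply]
    by_cases ha : Γ.Adj x.1 m.1
    · rw [h.compl.aut_letterVal_of_adj (x := x) ha, h.aut_letterVal_of_adj ha, MulAut.conj_apply,
        inv_inv, mul_assoc, letterVal_comm ha, inv_mul_cancel_left]
    · have hs : ∀ y : Letter V, y.1 = x.1 → side (complSide Γ P m) y = !side P y := by
        intro y hy
        by_cases hP : y ∈ P <;> simp [side, complSide, hy, ha, hP]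
      rw [h.compl.aut_letterVal (x := x) hx, h.aut_letterVal hx, MulAut.conj_apply, hs x rfl,
        hs x.inv rfl, boolVal_inv_not, boolVal_inv_not]
      group

theorem WhiteheadConditions.diff_union (hA : WhiteheadConditions Γ A m)
    (hP : WhiteheadConditions Γ P m) : WhiteheadConditions Γ (insert m (P \ A)) m := by
  refine .of_adj (Or.inl rfl) ?_ ?_ ?_
  · rintro (e | e)
    · exact m.inv_ne e
    · exact hP.inv_notMem e.1
  · rintro x (rfl | hx)
    · exact Γ.loopless.irrefl _
    · exact hP.not_adj x hx.1
  · rintro x y hxy hx hy (rfl | h)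
    · exact absurd rfl (notMem_star_iff.1 hx).1
    · exact Or.inr ⟨(hP.mem_iff_of_adj hxy hx hy).1 h.1,
        fun e => h.2 ((hA.mem_iff_of_adj hxy hx hy).2 e)⟩

theorem inversion_letterVal {x : Letter V} (hx : x.1 ≠ m.1) :
    whiteheadAut (inversion_conditions Γ m) (letterVal Γ x) = letterVal Γ x := by
  have h1 : ∀ y : Letter V, y.1 = x.1 → side {m} y = false := by
    rintro y hy
    rw [side_eq_false, Set.mem_singleton_iff]
    rintro rfl
    exact hx hy.symm
  rw [(inversion_conditions Γ m).aut_letterVal hx, h1 x rfl, h1 x.inv rfl]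
  simp

/-- Both factors insert powers of the same `m`. As `m ↦ m⁻¹`, the exponents subtract, leaving the
indicator of `P \ A`. -/
theorem whiteheadAut_mul_of_subset (hA : WhiteheadConditions Γ A m)
    (hP : WhiteheadConditions Γ P m) (hAP : A ⊆ P) :
    whiteheadAut hP * whiteheadAut hA =
      whiteheadAut (hA.diff_union hP) * whiteheadAut (inversion_conditions Γ m) := by
  refine aut_ext_letter (m := m) ?_ fun x hx => ?_
  · simp [MulAut.mul_apply, whiteheadAut_m]
  · have key : ∀ y : Letter V, y.1 = x.1 →
        boolVal Γ m (side (insert m (P \ A)) y) =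
          (boolVal Γ m (side A y))⁻¹ * boolVal Γ m (side P y) := by
      intro y hy
      have hym : y ≠ m := by rintro rfl; exact hx hy.symm
      by_cases h1 : y ∈ A
      · simp [boolVal, h1, hAP h1, hym]
      · by_cases h2 : y ∈ P <;> simp [boolVal, h1, h2, hym]
    rw [MulAut.mul_apply, MulAut.mul_apply, inversion_letterVal hx, hA.aut_letterVal hx,
      (hA.diff_union hP).aut_letterVal hx, map_mul, map_mul, map_inv, whiteheadAut_boolVal,
      whiteheadAut_boolVal, hP.aut_letterVal hx, key x rfl, key x.inv rfl]
    group

/-- Whitehead pairs based at distinct vertices commute if their sides are disjoint and neither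
side contains the inverse of the base of the other, or if their bases are adjacent. -/
theorem whiteheadAut_comm (hP : WhiteheadConditions Γ P v) (hQ : WhiteheadConditions Γ Q w)
    (hvw : v.1 ≠ w.1) (hvQ : ∀ x : Letter V, x.1 = v.1 → x ∉ Q)
    (hwP : ∀ x : Letter V, x.1 = w.1 → x ∉ P)
    (hd : Γ.Adj v.1 w.1 ∨ Disjoint P Q) :
    whiteheadAut hQ * whiteheadAut hP = whiteheadAut hP * whiteheadAut hQ := by
  have fixv : whiteheadAut hQ (letterVal Γ v) = letterVal Γ v := by
    rw [hQ.aut_letterVal hvw, side_eq_false.2 (hvQ v rfl), side_eq_false.2 (hvQ v.inv rfl)]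
    simp
  have fixw : whiteheadAut hP (letterVal Γ w) = letterVal Γ w := by
    rw [hP.aut_letterVal hvw.symm, side_eq_false.2 (hwP w rfl), side_eq_false.2 (hwP w.inv rfl)]
    simp
  have fixv' : ∀ s, whiteheadAut hQ (boolVal Γ v s) = boolVal Γ v s := by
    intro s; cases s
    · simp
    · exact fixv
  have fixw' : ∀ s, whiteheadAut hP (boolVal Γ w s) = boolVal Γ w s := by
    intro s; cases s
    · simp
    · exact fixw
  have comm : ∀ x : Letter V, boolVal Γ v (side P x) * boolVal Γ w (side Q x) =
      boolVal Γ w (side Q x) * boolVal Γ v (side P x) := by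
    intro x
    rcases hd with hd | hd
    · by_cases h1 : x ∈ P <;> by_cases h2 : x ∈ Q <;> simp [boolVal, h1, h2, letterVal_comm hd]
    · by_cases h1 : x ∈ P
      · simp [boolVal, h1, Set.disjoint_left.1 hd h1]
      · simp [boolVal, h1]
  refine aut_ext_letter (m := v) ?_ fun x hx => ?_
  · simp [MulAut.mul_apply, whiteheadAut_m, fixv]
  by_cases hxw : x.1 = w.1
  · rcases Letter.eq_or_eq_inv hxw with rfl | rfl <;>
      simp [MulAut.mul_apply, whiteheadAut_m, fixw, letterVal_inv]
  · rw [MulAut.mul_apply, MulAut.mul_apply, hP.aut_letterVal hx, hQ.aut_letterVal hxw]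
    simp only [map_mul, map_inv, fixv', fixw', hP.aut_letterVal hx, hQ.aut_letterVal hxw]
    have h1 := comm x
    have h2 := comm x.inv
    calc _ = (boolVal Γ v (side P x.inv) * boolVal Γ w (side Q x.inv)) * letterVal Γ x *
          (boolVal Γ v (side P x) * boolVal Γ w (side Q x))⁻¹ := by group
      _ = _ := by rw [h1, h2]; group

/-- An edge of `Γ ∖ st(v)` on the side `P` avoids `st(w)`: otherwise membership would propagate
along edges to `w ∈ P`. Hence `Q` does not separate its endpoints either. -/
theorem WhiteheadConditions.diff (hP : WhiteheadConditions Γ P v)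
    (hQ : WhiteheadConditions Γ Q w) (hvQ : v ∉ Q) (hwP : w ∉ P) (hvw : ¬ Γ.Adj v.1 w.1) :
    WhiteheadConditions Γ (P \ Q) v := by
  refine .of_adj ⟨hP.mem, hvQ⟩ (fun h => hP.inv_notMem h.1) (fun x hx => hP.not_adj x hx.1) ?_
  intro x y hxy hx hy hxP
  have hyP := (hP.mem_iff_of_adj hxy hx hy).1 hxP.1
  have out : ∀ {x y : Letter V}, Γ.Adj x.1 y.1 → x.1 ∉ star Γ v.1 → y.1 ∉ star Γ v.1 →
      x ∈ P → x.1 ∉ star Γ w.1 := by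
    intro x y hxy hx hy hxP
    have hyP := (hP.mem_iff_of_adj hxy hx hy).1 hxP
    refine notMem_star_iff.2 ⟨fun e => ?_, fun e => ?_⟩
    · rw [e] at hxy hx
      exact hwP ((hP.mem_iff_of_adj hxy hx hy).2 hyP)
    · by_cases hwv : w.1 = v.1
      · rw [hwv] at e
        exact (notMem_star_iff.1 hx).2 e
      · exact hwP ((hP.mem_iff_of_adj e hx
          (notMem_star_iff.2 ⟨hwv, fun e' => hvw e'.symm⟩)).1 hxP)
  exact ⟨hyP, fun hyQ => hxP.2 ((hQ.mem_iff_of_adj hxy (out hxy hx hy hxP.1)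
    (out hxy.symm hy hx hyP)).2 hyQ)⟩

theorem WhiteheadConditions.union_diff (hA : WhiteheadConditions Γ A v)
    (hQ : WhiteheadConditions Γ Q w) (hAQ : Disjoint A Q) (hvw : ¬ Γ.Adj v.1 w.1)
    (hv : v.inv ∈ Q) (hw : w.inv ∉ A) : WhiteheadConditions Γ ((A ∪ Q) \ {v.inv}) w := by
  have hvQ := Set.disjoint_left.1 hAQ hA.mem
  have hwA := Set.disjoint_right.1 hAQ hQ.mem
  have hne : v.1 ≠ w.1 := by
    intro e
    rcases Letter.eq_or_eq_inv e with rfl | rfl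
    · exact hvQ hQ.mem
    · exact hw hA.mem
  have hvs : v.1 ∉ star Γ w.1 := notMem_star_iff.2 ⟨hne, hvw⟩
  -- As `Q` separates `v` from `v⁻¹`, the vertex of `v` is isolated in `Γ ∖ st(w)`.
  have iso : ∀ y : Letter V, Γ.Adj v.1 y.1 → y.1 ∈ star Γ w.1 := by
    intro y hy
    by_contra hys
    exact hvQ ((hQ.mem_iff_of_adj hy hvs hys).2
      ((hQ.mem_iff_of_adj (x := v.inv) hy hvs hys).1 hv))
  refine .of_adj ⟨Or.inr hQ.mem, ?_⟩ ?_ ?_ ?_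
  · rintro (e : w = v.inv)
    exact hne (congrArg Prod.fst e).symm
  · rintro ⟨h | h, _⟩
    · exact hw h
    · exact hQ.inv_notMem h
  · rintro x ⟨hx | hx, _⟩
    · intro hxw
      refine hA.notMem_of_adj hwA (fun e => hvw e.symm) hxw (fun e => ?_) hx
      exact hA.not_adj x hx e
    · exact hQ.not_adj x hx
  · have hs : ∀ {x y : Letter V}, Γ.Adj x.1 y.1 → x.1 ∉ star Γ w.1 → y.1 ∉ star Γ w.1 →
        x.1 ∉ star Γ v.1 := by
      intro x y hxy hx hy
      refine notMem_star_iff.2 ⟨fun e => hy (iso y (e ▸ hxy)), fun e => hx (iso x e.symm)⟩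
    rintro x y hxy hx hy ⟨h, _⟩
    have hxs := hs hxy hx hy
    have hys := hs hxy.symm hy hx
    refine ⟨?_, ?_⟩
    · exact h.imp (hA.mem_iff_of_adj hxy hxs hys).1 (hQ.mem_iff_of_adj hxy hx hy).1
    · rintro (rfl : y = v.inv)
      exact (notMem_star_iff.1 hys).1 rfl

/-- Removing `v⁻¹` from `A ∪ Q` sends `v` to `v w⁻¹`. For letters of `A`, this factor `w⁻¹` cancels
the `w` contributed by `A ∪ Q`, so only letters of `Q` retain it. -/
theorem whiteheadAut_union_diff (hA : WhiteheadConditions Γ A v)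
    (hQ : WhiteheadConditions Γ Q w) (hR : WhiteheadConditions Γ ((A ∪ Q) \ {v.inv}) w)
    (hAQ : Disjoint A Q) (hv : v.inv ∈ Q) (hw : w.inv ∉ A) :
    whiteheadAut hR * whiteheadAut hA = whiteheadAut hA * whiteheadAut hQ := by
  have hvQ := Set.disjoint_left.1 hAQ hA.mem
  have hwA := Set.disjoint_right.1 hAQ hQ.mem
  have hne : v.1 ≠ w.1 := by
    intro e
    rcases Letter.eq_or_eq_inv e with rfl | rfl
    · exact hvQ hQ.mem
    · exact hw hA.mem
  have hvinv : v ≠ v.inv := fun e => v.inv_ne e.symm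
  have qv : whiteheadAut hQ (letterVal Γ v) = letterVal Γ w * letterVal Γ v := by
    simp [hQ.aut_letterVal hne, boolVal, hvQ, hv]
  have rv : whiteheadAut hR (letterVal Γ v) = letterVal Γ v * (letterVal Γ w)⁻¹ := by
    rw [hR.aut_letterVal hne]
    simp [boolVal, hA.mem, hvinv]
  have aw : whiteheadAut hA (letterVal Γ w) = letterVal Γ w := by
    simp [hA.aut_letterVal hne.symm, boolVal, hwA, hw]
  have aw' : ∀ s, whiteheadAut hA (boolVal Γ w s) = boolVal Γ w s := by
    intro s; cases s
    · simp
    · exact aw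
  refine aut_ext_letter (m := v) ?_ fun x hx => ?_
  · simp [MulAut.mul_apply, whiteheadAut_m, rv, qv, aw]
  by_cases hxw : x.1 = w.1
  · rcases Letter.eq_or_eq_inv hxw with rfl | rfl <;>
      simp [MulAut.mul_apply, whiteheadAut_m, aw, letterVal_inv]
  · have key : ∀ y : Letter V, y.1 = x.1 →
        whiteheadAut hR (boolVal Γ v (side A y)) *
          boolVal Γ w (side ((A ∪ Q) \ {v.inv}) y) =
        boolVal Γ w (side Q y) * boolVal Γ v (side A y) := by
      intro y hy
      have hyv : y ≠ v.inv := by rintro rfl; exact hx hy.symm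
      by_cases h1 : y ∈ A
      · simp [boolVal, h1, Set.disjoint_left.1 hAQ h1, hyv, rv]
      · by_cases h2 : y ∈ Q <;> simp [boolVal, h1, h2, hyv]
    have h1 := key x rfl
    have h2 := key x.inv rfl
    rw [MulAut.mul_apply, MulAut.mul_apply, hA.aut_letterVal hx, hQ.aut_letterVal hxw]
    simp only [map_mul, map_inv, aw', hA.aut_letterVal hx, hR.aut_letterVal hxw]
    calc _ = (whiteheadAut hR (boolVal Γ v (side A x.inv)) *
          boolVal Γ w (side ((A ∪ Q) \ {v.inv}) x.inv)) * letterVal Γ x *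
          (whiteheadAut hR (boolVal Γ v (side A x)) *
          boolVal Γ w (side ((A ∪ Q) \ {v.inv}) x))⁻¹ := by group
      _ = _ := by rw [h1, h2]; group

/-- With equal links, an edge of `Γ ∖ st(u)` cannot meet `v`, since the other endpoint would be
adjacent to `u`; so it is also an edge of `Γ ∖ st(v)`. -/
theorem WhiteheadConditions.exchange (hA : WhiteheadConditions Γ A v) (hu : u ∈ A)
    (hu' : u.inv ∉ A) (hl : ∀ a, Γ.Adj a v.1 ↔ Γ.Adj a u.1) :
    WhiteheadConditions Γ A u := by
  refine .of_adj hu hu' (fun x hx => by rw [← hl]; exact hA.not_adj x hx) ?_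
  intro x y hxy hx hy
  have hs : ∀ {x y : Letter V}, Γ.Adj x.1 y.1 → x.1 ∉ star Γ u.1 → y.1 ∉ star Γ u.1 →
      x.1 ∉ star Γ v.1 := by
    intro x y hxy hx hy
    refine notMem_star_iff.2 ⟨fun e => (notMem_star_iff.1 hy).2 ?_, ?_⟩
    · rw [← hl, ← e]
      exact hxy.symm
    · rw [hl]
      exact (notMem_star_iff.1 hx).2
  exact (hA.mem_iff_of_adj hxy (hs hxy hx hy) (hs hxy.symm hy hx)).1

/-- Exchanging two vertices with the same link is a symmetry. -/
theorem swap_mem_signedSymm {s : MulAut (RAAG Γ)} (hne : v.1 ≠ u.1)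
    (hl : ∀ a, Γ.Adj a v.1 ↔ Γ.Adj a u.1) (hv : s (letterVal Γ v) = letterVal Γ u)
    (hu : s (letterVal Γ u) = letterVal Γ v)
    (hx : ∀ a, a ≠ v.1 → a ≠ u.1 → s (gen Γ a) = gen Γ a) : toOut s ∈ signedSymm Γ := by
  classical
  have hvu : ¬ Γ.Adj v.1 u.1 := by
    rw [← hl]
    exact Γ.loopless.irrefl _
  have graph : ∀ {s : MulAut (RAAG Γ)}, s (gen Γ v.1) = gen Γ u.1 →
      s (gen Γ u.1) = gen Γ v.1 → (∀ a, a ≠ v.1 → a ≠ u.1 → s (gen Γ a) = gen Γ a) →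
      IsGraphAut Γ s := by
    intro s h1 h2 h3
    have hadj : ∀ {a b : V}, Γ.Adj a b →
        Γ.Adj (Equiv.swap v.1 u.1 a) (Equiv.swap v.1 u.1 b) := by
      intro a b hab
      have left : ∀ {a b : V}, Γ.Adj a b → Γ.Adj (Equiv.swap v.1 u.1 a) b := by
        intro a b hab
        rw [Equiv.swap_apply_def]
        split_ifs with e1 e2
        · rw [Γ.adj_comm, ← hl, ← e1]
          exact hab.symm
        · rw [Γ.adj_comm, hl, ← e2]
          exact hab.symm
        · exact hab
      exact (left (left hab).symm).symm
    refine ⟨⟨Equiv.swap v.1 u.1, ⟨fun h => ?_, hadj⟩⟩, fun a => ?_⟩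
    · simpa using hadj h
    · change s (gen Γ a) = gen Γ (Equiv.swap v.1 u.1 a)
      rw [Equiv.swap_apply_def]
      split_ifs with e1 e2
      · rw [e1, h1]
      · rw [e2, h2]
      · exact h3 a e1 e2
  have hgen : ∀ {s : MulAut (RAAG Γ)}, IsGraphAut Γ s → toOut s ∈ signedSymm Γ :=
    fun h => Subgroup.subset_closure ⟨_, Or.inl h, rfl⟩
  have hinv : ∀ x : Letter V, toOut (whiteheadAut (inversion_conditions Γ x)) ∈ signedSymm Γ :=
    fun x => Subgroup.subset_closure ⟨_, Or.inr (inversion_isInversion Γ x), rfl⟩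
  by_cases hsign : v.2 = u.2
  · refine hgen (graph ?_ ?_ hx)
    · revert hv
      simp only [letterVal, hsign]
      split_ifs <;> simp
    · revert hu
      simp only [letterVal, hsign]
      split_ifs <;> simp
  -- If the signs differ, inverting both vertices first turns the exchange into a graph
  -- automorphism.
  · set i := whiteheadAut (inversion_conditions Γ v) with hi
    set j := whiteheadAut (inversion_conditions Γ u) with hj
    have hiv : i (gen Γ v.1) = (gen Γ v.1)⁻¹ := by simp [hi, whiteheadAut_gen, whiteheadFun]
    have hju : j (gen Γ u.1) = (gen Γ u.1)⁻¹ := by simp [hj, whiteheadAut_gen, whiteheadFun]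
    have hix : ∀ a, a ≠ v.1 → i (gen Γ a) = gen Γ a := by
      intro a ha
      rw [← letterVal_true]
      exact inversion_letterVal ha
    have hjx : ∀ a, a ≠ u.1 → j (gen Γ a) = gen Γ a := by
      intro a ha
      rw [← letterVal_true]
      exact inversion_letterVal ha
    have hg : IsGraphAut Γ (s * (i * j)) := by
      refine graph ?_ ?_ ?_
      · rw [MulAut.mul_apply, MulAut.mul_apply, hjx _ hne, hiv, map_inv]
        revert hv hsign
        rcases v with ⟨a, b⟩
        rcases u with ⟨c, d⟩
        cases b <;> cases d <;> simp +contextual [letterVal]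
      · rw [MulAut.mul_apply, MulAut.mul_apply, hju, map_inv, hix _ hne.symm, map_inv]
        revert hu hsign
        rcases v with ⟨a, b⟩
        rcases u with ⟨c, d⟩
        cases b <;> cases d <;> simp +contextual [letterVal]
      · intro a h1 h2
        rw [MulAut.mul_apply, MulAut.mul_apply, hjx _ h2, hix _ h1, hx _ h1 h2]
    have hm := hgen hg
    rw [map_mul, map_mul] at hm
    exact (Subgroup.mul_mem_cancel_right _ (mul_mem (hinv v) (hinv u))).1 hm

/-- The triple product interchanges the letters `v` and `u`. It fixes the other generators because
the images of these under the `u`-based automorphism are fixed by the `v`-based one. -/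
theorem exchange_mem_signedSymm (hA : WhiteheadConditions Γ A v)
    (hA' : WhiteheadConditions Γ A u) (hne : v.1 ≠ u.1)
    (hl : ∀ a, Γ.Adj a v.1 ↔ Γ.Adj a u.1) :
    toOut (whiteheadAut hA' * whiteheadAut hA * whiteheadAut hA') ∈ signedSymm Γ := by
  have h1 : whiteheadAut hA (letterVal Γ u) = letterVal Γ u * (letterVal Γ v)⁻¹ := by
    simp [hA.aut_letterVal hne.symm, boolVal, hA'.mem, hA'.inv_notMem]
  have h2 : whiteheadAut hA' (letterVal Γ v) = letterVal Γ v * (letterVal Γ u)⁻¹ := by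
    simp [hA'.aut_letterVal hne, boolVal, hA.mem, hA.inv_notMem]
  have h3 := whiteheadAut_m hA
  have h4 := whiteheadAut_m hA'
  refine swap_mem_signedSymm hne hl ?_ ?_ fun a hav hau => ?_
  · simp [MulAut.mul_apply, h1, h2, h3, h4]
  · simp [MulAut.mul_apply, h1, h2, h4]
  · have h5 : ∀ s, whiteheadAut hA (boolVal Γ u s) * boolVal Γ v s = boolVal Γ u s := by
      intro s
      cases s <;> simp [h1]
    have h6 : whiteheadAut hA (whiteheadAut hA' (gen Γ a)) = whiteheadAut hA' (gen Γ a) := by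
      rw [← letterVal_true, hA'.aut_letterVal (x := (a, true)) hau]
      simp only [map_mul, map_inv, hA.aut_letterVal (x := (a, true)) hav]
      have h7 := h5 (side A (a, true))
      have h8 := h5 (side A (Letter.inv (a, true)))
      calc _ = (whiteheadAut hA (boolVal Γ u (side A (Letter.inv (a, true)))) *
            boolVal Γ v (side A (Letter.inv (a, true)))) * letterVal Γ (a, true) *
            (whiteheadAut hA (boolVal Γ u (side A (a, true))) *
            boolVal Γ v (side A (a, true)))⁻¹ := by group
        _ = _ := by rw [h7, h8]
    rw [MulAut.mul_apply, MulAut.mul_apply, h6, whiteheadAut_whiteheadAut]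

theorem mk_mul_of_mem {φ ψ : OutL Γ} {s : Out (RAAG Γ)} (hs : s ∈ signedSymm Γ)
    (h : (ψ : Out (RAAG Γ)) = φ * s) : MarkedSalvetti.mk Γ φ = MarkedSalvetti.mk Γ ψ := by
  refine QuotientGroup.eq.2 ?_
  rw [Subgroup.mem_subgroupOf, Subgroup.coe_mul, Subgroup.coe_inv, h, inv_mul_cancel_left]
  exact hs

/-- Separation of `v` from its inverse gives `v ≤ w` by condition (2); non-adjacency improves this
to inclusion of links. Used in both directions, it yields equal links. -/
theorem WhiteheadConditions.adj_of_separated (hQ : WhiteheadConditions Γ Q w) (hv : v.inv ∈ Q)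
    (hv' : v ∉ Q) (hvw : ¬ Γ.Adj v.1 w.1) {a : V} (ha : Γ.Adj a v.1) : Γ.Adj a w.1 := by
  have h1 : a ∈ star Γ w.1 := hQ.le v.inv hv (by rwa [Letter.inv_inv]) ha.symm
  rcases h1 with rfl | h1
  · exact absurd ha.symm hvw
  · exact Γ.adj_symm h1

theorem mem_complSide_iff (h : ¬ Γ.Adj u.1 m.1) : u ∈ complSide Γ P m ↔ u ∉ P :=
  ⟨fun hu => hu.1, fun hu => ⟨hu, h⟩⟩

end Moves

/-! ### Peak reduction -/

section Paths

variable {V : Type*} [Finite V] {Γ : SimpleGraph V} {P Q A B R : Set (Letter V)}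
  {m u v w : Letter V}

/-- The long-range outer automorphism of a possibly degenerate Whitehead pair. -/
noncomputable def conditionsOut (h : WhiteheadConditions Γ P m) : OutL Γ :=
  ⟨toOut (whiteheadAut h), whiteheadAut_mem h⟩

/-- The result of the move at `(𝕊, φ)` along a possibly degenerate Whitehead pair. -/
noncomputable def conditionsMove (φ : OutL Γ) (h : WhiteheadConditions Γ P m) :
    MarkedSalvetti Γ :=
  MarkedSalvetti.mk Γ (φ * conditionsOut h)

/-- Two marked Salvettis are equal or related by a Whitehead move. -/
def Near (τ τ' : MarkedSalvetti Γ) : Prop := τ = τ' ∨ IsWhiteheadMove τ τ'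

theorem conditionsOut_mul_self (h : WhiteheadConditions Γ P m) :
    conditionsOut h * conditionsOut h = 1 := by
  apply Subtype.ext
  change toOut (whiteheadAut h) * toOut (whiteheadAut h) = 1
  rw [← map_mul, whiteheadAut_sq, map_one]

theorem IsWhiteheadMove.symm {τ τ' : MarkedSalvetti Γ} (h : IsWhiteheadMove τ τ') :
    IsWhiteheadMove τ' τ := by
  obtain ⟨φ, P, m, hP, rfl, rfl⟩ := h
  refine ⟨φ * whiteheadOut hP, P, m, hP, rfl, ?_⟩
  have h1 : whiteheadOut hP * whiteheadOut hP = 1 :=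
    conditionsOut_mul_self hP.toWhiteheadConditions
  rw [whiteheadMove, mul_assoc, h1, mul_one]

theorem Near.symm {τ τ' : MarkedSalvetti Γ} (h : Near τ τ') : Near τ' τ :=
  h.imp Eq.symm IsWhiteheadMove.symm

/-- Uncrossing may produce the one-letter side `{m}`. Its automorphism is an inversion, so the
marked Salvetti does not change. -/
theorem near_conditionsMove (φ : OutL Γ) (h : WhiteheadConditions Γ P m) :
    Near (MarkedSalvetti.mk Γ φ) (conditionsMove φ h) := by
  by_cases hn : P.Nontrivial
  · exact Or.inr ⟨φ, P, m, ⟨h, hn⟩, rfl, rfl⟩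
  · obtain rfl : P = {m} := (Set.not_nontrivial_iff.1 hn).eq_singleton_of_mem h.mem
    exact Or.inl (mk_mul_of_mem
      (Subgroup.subset_closure ⟨_, Or.inr (inversion_isInversion Γ m), rfl⟩) rfl)

theorem near_of_mul_eq (φ : OutL Γ) (hA : WhiteheadConditions Γ A u)
    (hB : WhiteheadConditions Γ B v) (hR : WhiteheadConditions Γ R w) {s : MulAut (RAAG Γ)}
    (hs : toOut s ∈ signedSymm Γ)
    (h : whiteheadAut hB * whiteheadAut hA = whiteheadAut hR * s) :
    Near (conditionsMove φ hB) (conditionsMove φ hA) := by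
  have h1 : conditionsMove (φ * conditionsOut hB) hR = conditionsMove φ hA := by
    refine mk_mul_of_mem hs ?_
    have h2 : toOut (whiteheadAut hA) =
        toOut (whiteheadAut hB) * (toOut (whiteheadAut hR) * toOut s) := by
      rw [← map_mul toOut, ← h, ← map_mul, ← mul_assoc, whiteheadAut_sq, one_mul]
    change (φ : Out (RAAG Γ)) * toOut (whiteheadAut hA) =
      φ * toOut (whiteheadAut hB) * toOut (whiteheadAut hR) * toOut s
    rw [h2]
    simp only [mul_assoc]
  rw [← h1]
  exact near_conditionsMove _ hR

theorem conditionsMove_compl (φ : OutL Γ) (h : WhiteheadConditions Γ P m) :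
    conditionsMove φ h.compl = conditionsMove φ h := by
  have h1 : conditionsOut h.compl = conditionsOut h := by
    apply Subtype.ext
    change toOut (whiteheadAut h.compl) = toOut (whiteheadAut h)
    rw [h.aut_compl, map_mul]
    have h2 : toOut (MulAut.conj (letterVal Γ m)⁻¹) = 1 :=
      (QuotientGroup.eq_one_iff _).2 ⟨_, rfl⟩
    rw [h2, one_mul]
  rw [conditionsMove, h1, conditionsMove]

theorem near_of_subset (φ : OutL Γ) (hA : WhiteheadConditions Γ A m)
    (hP : WhiteheadConditions Γ P m) (hAP : A ⊆ P) :
    Near (conditionsMove φ hP) (conditionsMove φ hA) :=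
  near_of_mul_eq φ hA hP (hA.diff_union hP)
    (Subgroup.subset_closure ⟨_, Or.inr (inversion_isInversion Γ m), rfl⟩)
    (whiteheadAut_mul_of_subset hA hP hAP)

theorem near_of_disjoint (φ : OutL Γ) (hA : WhiteheadConditions Γ A m.inv)
    (hP : WhiteheadConditions Γ P m) (hAP : Disjoint A P) :
    Near (conditionsMove φ hP) (conditionsMove φ hA) := by
  rw [← conditionsMove_compl φ hP]
  exact near_of_subset φ hA hP.compl fun x hx =>
    ⟨Set.disjoint_left.1 hAP hx, hA.not_adj x hx⟩

theorem near_exchange (φ : OutL Γ) (hA : WhiteheadConditions Γ A v)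
    (hA' : WhiteheadConditions Γ A u) (hne : v.1 ≠ u.1)
    (hl : ∀ a, Γ.Adj a v.1 ↔ Γ.Adj a u.1) :
    Near (conditionsMove φ hA) (conditionsMove φ hA') := by
  refine near_of_mul_eq φ hA' hA hA' (exchange_mem_signedSymm hA hA' hne hl) ?_
  rw [mul_assoc, ← mul_assoc (whiteheadAut hA'), whiteheadAut_sq, one_mul]

/-- Marked Salvettis joined by a Whitehead path all of whose terms except possibly the last one
have norm less than `N`. -/
def PathBelow (N : ℕ) : MarkedSalvetti Γ → MarkedSalvetti Γ → Prop :=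
  Relation.ReflTransGen fun τ τ' => normZero Γ τ < N ∧ IsWhiteheadMove τ τ'

theorem Near.pathBelow {N : ℕ} {τ τ' : MarkedSalvetti Γ} (h : Near τ τ')
    (hN : normZero Γ τ < N) : PathBelow N τ τ' := by
  rcases h with rfl | h
  · exact .refl
  · exact .single ⟨hN, h⟩

theorem PathBelow.exists_path {N : ℕ} {σ σ' : MarkedSalvetti Γ} (h : PathBelow N σ σ') :
    ∃ (k : ℕ) (τ : ℕ → MarkedSalvetti Γ),
      IsWhiteheadPath σ σ' k τ ∧ ∀ i < k, normZero Γ (τ i) < N := by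
  induction h using Relation.ReflTransGen.head_induction_on with
  | refl => exact ⟨0, fun _ => σ', ⟨rfl, rfl, fun i hi => absurd hi (by simp)⟩, by simp⟩
  | @head σ ρ h _ ih =>
    obtain ⟨k, τ, hτ, hN⟩ := ih
    -- The path `τ` is shifted by one and preceded by `σ`.
    refine ⟨k + 1, fun i => Nat.casesOn i σ τ, ⟨rfl, hτ.finish, ?_⟩, ?_⟩
    · rintro (_ | i) hi
      · change IsWhiteheadMove σ (τ 0)
        rw [hτ.start]
        exact h.2
      · exact hτ.move i (by lia)
    · rintro (_ | i) hi
      · exact h.1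
      · exact hN i (by lia)

theorem wordLength_add_le_normZero (φ : OutL Γ) {P₁ P₂ P₃ P₄ : Set (Letter V)}
    {m₁ m₂ m₃ m₄ : Letter V} (h₁ : WhiteheadConditions Γ P₁ m₁)
    (h₂ : WhiteheadConditions Γ P₂ m₂) (h₃ : WhiteheadConditions Γ P₃ m₃)
    (h₄ : WhiteheadConditions Γ P₄ m₄)
    (h : ∀ a, wordLength (whiteheadAut h₁ a) + wordLength (whiteheadAut h₂ a) ≤
      wordLength (whiteheadAut h₃ a) + wordLength (whiteheadAut h₄ a)) :
    normZero Γ (conditionsMove φ h₁) + normZero Γ (conditionsMove φ h₂) ≤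
      normZero Γ (conditionsMove φ h₃) + normZero Γ (conditionsMove φ h₄) := by
  have hinv : ∀ {P : Set (Letter V)} {m : Letter V} (h : WhiteheadConditions Γ P m),
      (whiteheadAut h)⁻¹ = whiteheadAut h := fun h => inv_eq_of_mul_eq_one_left (whiteheadAut_sq h)
  refine normZero_add_le φ rfl rfl rfl rfl fun a => ?_
  simpa only [hinv] using h a

/-- A square of Whitehead automorphisms yields a path through its fourth corner. -/
theorem pathBelow_of_square {φ : OutL Γ} {P' Q' : Set (Letter V)}
    (hP : WhiteheadConditions Γ P v) (hQ : WhiteheadConditions Γ Q w)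
    (hP' : WhiteheadConditions Γ P' v) (hQ' : WhiteheadConditions Γ Q' w) (hvw : v.1 ≠ w.1)
    (hsq : whiteheadAut hQ' * whiteheadAut hP = whiteheadAut hP' * whiteheadAut hQ)
    (hPlt : normZero Γ (conditionsMove φ hP) < normZero Γ (MarkedSalvetti.mk Γ φ))
    (hQle : normZero Γ (conditionsMove φ hQ) ≤ normZero Γ (MarkedSalvetti.mk Γ φ)) :
    PathBelow (normZero Γ (MarkedSalvetti.mk Γ φ)) (conditionsMove φ hP)
      (conditionsMove φ hQ) := by
  have hinv : ∀ {P : Set (Letter V)} {m : Letter V} (h : WhiteheadConditions Γ P m),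
      (whiteheadAut h)⁻¹ = whiteheadAut h := fun h => inv_eq_of_mul_eq_one_left (whiteheadAut_sq h)
  -- Lengths at a marking use inverse automorphisms, so `hsq` describes the square of lengths; its
  -- inverse describes the square of markings.
  have hsq' : whiteheadAut hP * whiteheadAut hQ' = whiteheadAut hQ * whiteheadAut hP' := by
    rw [← hinv hP, ← hinv hQ', ← mul_inv_rev, hsq, mul_inv_rev, hinv, hinv]
  have hmid : conditionsMove (φ * conditionsOut hP) hQ' =
      conditionsMove (φ * conditionsOut hQ) hP' := by
    have h1 : conditionsOut hP * conditionsOut hQ' = conditionsOut hQ * conditionsOut hP' := by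
      apply Subtype.ext
      change toOut (whiteheadAut hP) * toOut (whiteheadAut hQ') =
        toOut (whiteheadAut hQ) * toOut (whiteheadAut hP')
      rw [← map_mul, hsq', map_mul]
    rw [conditionsMove, mul_assoc, h1, ← mul_assoc, conditionsMove]
  have hnorm := normZero_add_le φ (A := conditionsOut hP * conditionsOut hQ') (B := 1)
    (C := conditionsOut hP) (D := conditionsOut hQ) (α := whiteheadAut hP * whiteheadAut hQ')
    (β := 1) (γ := whiteheadAut hP) (δ := whiteheadAut hQ) (map_mul toOut _ _).symm
    (map_one toOut).symm rfl rfl (fun a => by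
      rw [mul_inv_rev, hinv, hinv, inv_one, MulAut.mul_apply, MulAut.one_apply]
      exact (wordLength_square hP hQ hP' hQ' hvw hsq a).le)
  rw [mul_one, ← mul_assoc] at hnorm
  change normZero Γ (conditionsMove (φ * conditionsOut hP) hQ') + _ ≤
    normZero Γ (conditionsMove φ hP) + normZero Γ (conditionsMove φ hQ) at hnorm
  refine ((near_conditionsMove (φ * conditionsOut hP) hQ').pathBelow hPlt).trans ?_
  -- The inequality `hnorm` puts the fourth corner strictly below σ.
  refine Near.pathBelow ?_ (by lia)
  rw [hmid]
  exact (near_conditionsMove (φ * conditionsOut hQ) hP').symm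

/-- Peak reduction for Whitehead pairs with disjoint sides. -/
theorem pathBelow_of_disjoint {φ : OutL Γ} (hA : WhiteheadConditions Γ A v)
    (hQ : WhiteheadConditions Γ Q w) (hAQ : Disjoint A Q) (hvw : ¬ Γ.Adj v.1 w.1)
    (hAlt : normZero Γ (conditionsMove φ hA) < normZero Γ (MarkedSalvetti.mk Γ φ))
    (hQle : normZero Γ (conditionsMove φ hQ) ≤ normZero Γ (MarkedSalvetti.mk Γ φ)) :
    PathBelow (normZero Γ (MarkedSalvetti.mk Γ φ)) (conditionsMove φ hA)
      (conditionsMove φ hQ) := by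
  have hvQ := Set.disjoint_left.1 hAQ hA.mem
  have hwA := Set.disjoint_right.1 hAQ hQ.mem
  by_cases hne : v.1 = w.1
  · rcases Letter.eq_or_eq_inv hne with rfl | rfl
    · exact absurd hQ.mem hvQ
    · exact (near_of_disjoint φ hA hQ hAQ).symm.pathBelow hAlt
  have hwv : ¬ Γ.Adj w.1 v.1 := fun e => hvw e.symm
  by_cases hv : v.inv ∈ Q <;> by_cases hw : w.inv ∈ A
  · have hl : ∀ a, Γ.Adj a v.1 ↔ Γ.Adj a w.1 := fun a =>
      ⟨hQ.adj_of_separated hv hvQ hvw, hA.adj_of_separated hw hwA hwv⟩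
    have hA' : WhiteheadConditions Γ A w.inv :=
      hA.exchange hw (by rwa [Letter.inv_inv]) hl
    have hQ' : WhiteheadConditions Γ Q v.inv :=
      hQ.exchange hv (by rwa [Letter.inv_inv]) fun a => (hl a).symm
    have hsum := wordLength_add_le_normZero φ hA' hQ' hA hQ fun a =>
      (wordLength_exchange hA hQ hA' hQ' rfl rfl hl a).le
    -- Each of the two rebased pairs is one move away from both ends, and by `hsum` one of them lies
    -- below σ.
    by_cases hlt : normZero Γ (conditionsMove φ hA') < normZero Γ (MarkedSalvetti.mk Γ φ)
    · exact ((near_exchange φ hA hA' hne hl).pathBelow hAlt).trans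
        ((near_of_disjoint φ hA' hQ hAQ).symm.pathBelow hlt)
    · exact ((near_of_disjoint φ hQ' hA hAQ.symm).pathBelow hAlt).trans
        ((near_exchange φ hQ' hQ hne hl).pathBelow (by lia))
  · exact pathBelow_of_square hA hQ hA (hA.union_diff hQ hAQ hvw hv hw) hne
      (whiteheadAut_union_diff hA hQ _ hAQ hv hw) hAlt hQle
  · exact pathBelow_of_square hA hQ (hQ.union_diff hA hAQ.symm hwv hw hv) hQ hne
      (whiteheadAut_union_diff hQ hA _ hAQ.symm hw hv).symm hAlt hQle
  · refine pathBelow_of_square hA hQ hA hQ hne (whiteheadAut_comm hA hQ hne ?_ ?_ (Or.inr hAQ))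
      hAlt hQle
    · intro x hx
      rcases Letter.eq_or_eq_inv hx with rfl | rfl
      exacts [hvQ, hv]
    · intro x hx
      rcases Letter.eq_or_eq_inv hx with rfl | rfl
      exacts [hwA, hw]

theorem normZero_diff_add_le (φ : OutL Γ) (hP : WhiteheadConditions Γ P v)
    (hQ : WhiteheadConditions Γ Q w) (hA : WhiteheadConditions Γ (P \ Q) v)
    (hB : WhiteheadConditions Γ (Q \ P) w) (hvw : ¬ Γ.Adj v.1 w.1) :
    normZero Γ (conditionsMove φ hA) + normZero Γ (conditionsMove φ hB) ≤
      normZero Γ (conditionsMove φ hP) + normZero Γ (conditionsMove φ hQ) :=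
  wordLength_add_le_normZero φ hA hB hP hQ (wordLength_diff_add_le hP hQ hA hB hvw)

/-- Peak reduction if neither side contains the base of the other pair. -/
theorem pathBelow_of_notMem {φ : OutL Γ} (hP : WhiteheadConditions Γ P v)
    (hQ : WhiteheadConditions Γ Q w) (hvQ : v ∉ Q) (hwP : w ∉ P) (hvw : ¬ Γ.Adj v.1 w.1)
    (hPlt : normZero Γ (conditionsMove φ hP) < normZero Γ (MarkedSalvetti.mk Γ φ))
    (hQle : normZero Γ (conditionsMove φ hQ) ≤ normZero Γ (MarkedSalvetti.mk Γ φ)) :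
    PathBelow (normZero Γ (MarkedSalvetti.mk Γ φ)) (conditionsMove φ hP)
      (conditionsMove φ hQ) := by
  have hA := hP.diff hQ hvQ hwP hvw
  have hB := hQ.diff hP hwP hvQ fun e => hvw e.symm
  have hsum := normZero_diff_add_le φ hP hQ hA hB hvw
  by_cases hlt : normZero Γ (conditionsMove φ hA) < normZero Γ (MarkedSalvetti.mk Γ φ)
  · exact ((near_of_subset φ hA hP Set.sdiff_subset).pathBelow hPlt).trans
      (pathBelow_of_disjoint hA hQ Set.disjoint_sdiff_left hvw hlt hQle)
  · have hlt' : normZero Γ (conditionsMove φ hB) < normZero Γ (MarkedSalvetti.mk Γ φ) := by lia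
    exact (pathBelow_of_disjoint hP hB Set.disjoint_sdiff_right hvw hPlt hlt'.le).trans
      ((near_of_subset φ hB hQ Set.sdiff_subset).symm.pathBelow hlt')

/-- Peak reduction if each of the four quadrants contains exactly one of `v`, `v⁻¹`, `w`,
`w⁻¹`. -/
theorem pathBelow_of_quadrants {φ : OutL Γ} (hP : WhiteheadConditions Γ P v)
    (hQ : WhiteheadConditions Γ Q w) (hv : v ∈ Q) (hv' : v.inv ∉ Q) (hw : w ∉ P)
    (hw' : w.inv ∈ P) (hvw : ¬ Γ.Adj v.1 w.1)
    (hPlt : normZero Γ (conditionsMove φ hP) < normZero Γ (MarkedSalvetti.mk Γ φ))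
    (hQle : normZero Γ (conditionsMove φ hQ) ≤ normZero Γ (MarkedSalvetti.mk Γ φ)) :
    PathBelow (normZero Γ (MarkedSalvetti.mk Γ φ)) (conditionsMove φ hP)
      (conditionsMove φ hQ) := by
  have hwv : ¬ Γ.Adj w.1 v.1 := fun e => hvw e.symm
  have hl : ∀ a, Γ.Adj a v.1 ↔ Γ.Adj a w.1 := fun a =>
    ⟨hQ.adj_of_separated (v := v.inv) (by rwa [Letter.inv_inv]) hv' hvw,
      hP.adj_of_separated hw' hw hwv⟩
  have hPw : WhiteheadConditions Γ P w.inv := hP.exchange hw' (by rwa [Letter.inv_inv]) hl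
  have hQv : WhiteheadConditions Γ Q v := hQ.exchange hv hv' fun a => (hl a).symm
  have hvv : ¬ Γ.Adj v.1 v.inv.1 := Γ.loopless.irrefl _
  have hww : ¬ Γ.Adj w.inv.1 w.1 := Γ.loopless.irrefl _
  -- The quadrants: `hX` is `P ∩ Q` based at `v`, `hY` the outside of both based at `v⁻¹`, `hZ` is
  -- `P \ Q` based at `w⁻¹`, and `hT` is `Q \ P` based at `w`.
  have hX := hP.diff hQv.compl (fun h => h.1 hv) hP.inv_notMem hvv
  have hY := hQv.compl.diff hP hP.inv_notMem (fun h => h.1 hv) hvv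
  have hZ := hPw.diff hQ hQ.inv_notMem hw hww
  have hT := hQ.diff hPw hw hQ.inv_notMem hww
  have h1 := normZero_diff_add_le φ hP hQv.compl hX hY hvv
  have h2 := normZero_diff_add_le φ hPw hQ hZ hT hww
  have h3 := wordLength_add_le_normZero φ hPw hQv hP hQ fun a =>
    (wordLength_exchange hP hQ hPw hQv rfl rfl hl a).le
  rw [conditionsMove_compl φ hQv] at h1
  have hcompl : complSide Γ Q v = complSide Γ Q w :=
     Set.ext fun x => and_congr_right fun _ => not_congr (hl x.1)
  by_cases hlX : normZero Γ (conditionsMove φ hX) < normZero Γ (MarkedSalvetti.mk Γ φ)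
  · rw [← conditionsMove_compl φ hQ] at hQle ⊢
    refine ((near_of_subset φ hX hP Set.sdiff_subset).pathBelow hPlt).trans
      (pathBelow_of_disjoint hX hQ.compl ?_ hvw hlX hQle)
    rw [hcompl]
    exact Set.disjoint_sdiff_left
  by_cases hlY : normZero Γ (conditionsMove φ hY) < normZero Γ (MarkedSalvetti.mk Γ φ)
  · refine ((near_of_disjoint φ hY hP Set.disjoint_sdiff_left).pathBelow hPlt).trans
      (pathBelow_of_disjoint hY hQ ?_ hvw hlY hQle)
    exact Set.disjoint_left.2 fun x hx => hx.1.1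
  by_cases hlZ : normZero Γ (conditionsMove φ hZ) < normZero Γ (MarkedSalvetti.mk Γ φ)
  · rw [← conditionsMove_compl φ hP] at hPlt ⊢
    refine (pathBelow_of_disjoint hP.compl hZ ?_ hvw hPlt hlZ.le).trans
      ((near_of_disjoint φ hZ hQ Set.disjoint_sdiff_left).symm.pathBelow hlZ)
    exact Set.disjoint_left.2 fun x hx hx' => hx.1 hx'.1
  -- By `h1`, `h2` and `h3` the four norms add up to less than four times that of σ.
  · have hlT : normZero Γ (conditionsMove φ hT) < normZero Γ (MarkedSalvetti.mk Γ φ) := by lia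
    exact (pathBelow_of_disjoint hP hT Set.disjoint_sdiff_right hvw hPlt hlT.le).trans
      ((near_of_subset φ hT hQ Set.sdiff_subset).symm.pathBelow hlT)

/-- For non-adjacent bases, the four choices of complements cover every position of `v`, `v⁻¹`
relative to `Q` and `w`, `w⁻¹` relative to `P`, except two. These are the quadrant configuration and
its image under complementing `P`. -/
theorem pathBelow_of_whitehead {φ : OutL Γ} (hP : WhiteheadConditions Γ P v)
    (hQ : WhiteheadConditions Γ Q w)
    (hPlt : normZero Γ (conditionsMove φ hP) < normZero Γ (MarkedSalvetti.mk Γ φ))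
    (hQle : normZero Γ (conditionsMove φ hQ) ≤ normZero Γ (MarkedSalvetti.mk Γ φ)) :
    PathBelow (normZero Γ (MarkedSalvetti.mk Γ φ)) (conditionsMove φ hP)
      (conditionsMove φ hQ) := by
  by_cases hvw : Γ.Adj v.1 w.1
  · refine pathBelow_of_square hP hQ hP hQ hvw.ne (whiteheadAut_comm hP hQ hvw.ne ?_ ?_
      (Or.inl hvw)) hPlt hQle
    · exact fun x hx h => hQ.not_adj x h (hx ▸ hvw)
    · exact fun x hx h => hP.not_adj x h (hx ▸ hvw.symm)
  have hwv : ¬ Γ.Adj w.1 v.1 := fun e => hvw e.symm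
  have hPc := conditionsMove_compl φ hP
  have hQc := conditionsMove_compl φ hQ
  have cP : ∀ x : Letter V, x.1 = w.1 → (x ∈ complSide Γ P v ↔ x ∉ P) := fun x hx =>
    mem_complSide_iff (by rwa [hx])
  have cQ : ∀ x : Letter V, x.1 = v.1 → (x ∈ complSide Γ Q w ↔ x ∉ Q) := fun x hx =>
    mem_complSide_iff (by rwa [hx])
  by_cases h1 : v ∈ Q
  · by_cases h2 : w.inv ∈ P
    · by_cases h3 : v.inv ∈ Q
      · rw [← hPc] at hPlt ⊢
        rw [← hQc] at hQle ⊢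
        exact pathBelow_of_notMem hP.compl hQ.compl (fun h => (cQ v.inv rfl).1 h h3)
          (fun h => (cP w.inv rfl).1 h h2) hvw hPlt hQle
      · by_cases h4 : w ∈ P
        · rw [← hPc] at hPlt ⊢
          exact pathBelow_of_notMem hP.compl hQ h3 (fun h => (cP w rfl).1 h h4) hvw hPlt hQle
        · exact pathBelow_of_quadrants hP hQ h1 h3 h4 h2 hvw hPlt hQle
    · rw [← hQc] at hQle ⊢
      exact pathBelow_of_notMem hP hQ.compl (fun h => (cQ v rfl).1 h h1) h2 hvw hPlt hQle
  · by_cases h2 : w ∈ P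
    · by_cases h3 : v.inv ∈ Q
      · rw [← hPc] at hPlt ⊢
        by_cases h4 : w.inv ∈ P
        · rw [← hQc] at hQle ⊢
          exact pathBelow_of_notMem hP.compl hQ.compl (fun h => (cQ v.inv rfl).1 h h3)
            (fun h => (cP w.inv rfl).1 h h4) hvw hPlt hQle
        · exact pathBelow_of_quadrants hP.compl hQ h3 (by rwa [Letter.inv_inv])
            (fun h => (cP w rfl).1 h h2) ((cP w.inv rfl).2 h4) hvw hPlt hQle
      · rw [← hPc] at hPlt ⊢
        exact pathBelow_of_notMem hP.compl hQ h3 (fun h => (cP w rfl).1 h h2) hvw hPlt hQle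
    · exact pathBelow_of_notMem hP hQ h1 h2 hvw hPlt hQle

end Paths

end WhiteheadRAAG

open WhiteheadRAAG in
theorem mainTheorem4 {V : Type*} [Finite V] (Γ : SimpleGraph V) (φ : OutL Γ)
    (P Q : Set (Letter V)) (v w : Letter V)
    (hP : IsWhiteheadPair Γ P v) (hQ : IsWhiteheadPair Γ Q w)
    (hPred : normZero Γ (whiteheadMove φ hP) < normZero Γ (MarkedSalvetti.mk Γ φ))
    (hQred : normZero Γ (whiteheadMove φ hQ) ≤ normZero Γ (MarkedSalvetti.mk Γ φ)) :
    ∃ (k : ℕ) (τ : ℕ → MarkedSalvetti Γ),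
      IsWhiteheadPath (whiteheadMove φ hP) (whiteheadMove φ hQ) k τ ∧
      ∀ i < k, normZero Γ (τ i) < normZero Γ (MarkedSalvetti.mk Γ φ) :=
  (pathBelow_of_whitehead hP.toWhiteheadConditions hQ.toWhiteheadConditions hPred
    hQred).exists_path
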